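/- A signed graph $\Sigma=(G,\sigma)$ consists of a finite loopless multigraph $G$ and a map $\sigma\colon E(G)\to\{+1,-1\}$, where two edges joining the same pair of vertices are allowed if they have opposite signs but not if they have the same sign. A map $f\colon V(\Sigma)\to\mathbb{Z}\setminus\{0\}$ is a proper coloring of $\Sigma$ if $f(u)\neq\sigma(e)f(v)$ whenever $u$ and $v$ are joined by an edge $e$. The zero-free chromatic number $\chi^*(\Sigma)$ is the minimum even integer $2k$ (with $k\ge 0$ an integer) such that $\Sigma$ has a proper coloring with all values in $\{\pm1,\pm2,\ldots,\pm k\}$. The zero-free list chromatic number $\chi^*_l(\Sigma)$ is the minimum even integer $2k$ (with $k\ge 0$ an integer) such that, for every assignment of a set $L(v)\subseteq\mathbb{Z}\setminus\{0\}$ with $|L(v)|\ge 2k$ to each vertex $v$, there is a proper coloring $f$ of $\Sigma$ with $f(v)\in L(v)$ for all $v\in V(\Sigma)$. Theorem. If $|V(\Sigma)|\le\chi^*(\Sigma)+1$, then $\Sigma$ is zero-free chromatic-choosable, that is, $\chi^*_l(\Sigma)=\chi^*(\Sigma)$. -/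

import Mathlib

/-- A signed graph with vertex type `V` and edge type `E`: a loopless multigraph whose edges carry
signs `+1` or `-1`, where two edges joining the same pair of vertices are allowed only if their
signs are opposite. -/
structure SignedGraph (V E : Type*) where
  /-- the unordered pair of end vertices of an edge -/
  ends : E → Sym2 V
  /-- the sign of an edge -/
  sign : E → ℤˣ
  loopless : ∀ e : E, ¬ (ends e).IsDiag
  eq_of_ends_of_sign : ∀ e e' : E, ends e = ends e' → sign e = sign e' → e = e'

namespace SignedGraph

variable {V E : Type*}

/-- The map `f` satisfies `f u ≠ σ(e) * f v` whenever `u` and `v` are joined by the edge `e`. -/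
def IsProper (S : SignedGraph V E) (f : V → ℤ) : Prop :=
  ∀ (e : E) (u v : V), S.ends e = s(u, v) → f u ≠ (S.sign e : ℤ) * f v

/-- The color set `{±1, ±2, …, ±k}`. -/
def zeroFreeColors (k : ℕ) : Set ℤ := {c : ℤ | c ≠ 0 ∧ |c| ≤ (k : ℤ)}

/-- `S` is zero-free `2k`-colorable: it has a proper coloring with color set `{±1, …, ±k}`. -/
def ZeroFreeColorable (S : SignedGraph V E) (k : ℕ) : Prop :=
  ∃ f : V → ℤ, S.IsProper f ∧ ∀ v, f v ∈ zeroFreeColors k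

/-- `S` is `L`-colorable: it has a proper coloring `f` with `f v ∈ L v` for every vertex `v`. -/
def ListColorable (S : SignedGraph V E) (L : V → Set ℤ) : Prop :=
  ∃ f : V → ℤ, S.IsProper f ∧ ∀ v, f v ∈ L v

/-- `S` is `L`-colorable for every assignment `L` of (possibly infinite) sets of nonzero integers
with at least `2k` elements each. -/
def ZeroFreeChoosable (S : SignedGraph V E) (k : ℕ) : Prop :=
  ∀ L : V → Set ℤ, (∀ v, (0 : ℤ) ∉ L v) → (∀ v, ((2 * k : ℕ) : ℕ∞) ≤ (L v).encard) →
    S.ListColorable L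

/-- The zero-free chromatic number `χ*`: the minimum even number `2k` for which the signed graph
is zero-free `2k`-colorable. For finite `V` the minimum exists, see
`isLeast_zeroFreeChromaticNumber`. -/
noncomputable def zeroFreeChromaticNumber (S : SignedGraph V E) : ℕ :=
  sInf {m : ℕ | ∃ k : ℕ, m = 2 * k ∧ S.ZeroFreeColorable k}

/-- The zero-free list chromatic number `χ*_l`: the minimum even number `2k` for which the signed
graph is `L`-colorable for all zero-free list assignments with lists of size at least `2k`. For
finite `V` the minimum exists, see `isLeast_zeroFreeListChromaticNumber`. -/
noncomputable def zeroFreeListChromaticNumber (S : SignedGraph V E) : ℕ :=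
  sInf {m : ℕ | ∃ k : ℕ, m = 2 * k ∧ S.ZeroFreeChoosable k}

/-- `S` is zero-free chromatic-choosable: `χ*_l = χ*`. -/
def ZeroFreeChromaticChoosable (S : SignedGraph V E) : Prop :=
  S.zeroFreeListChromaticNumber = S.zeroFreeChromaticNumber

theorem isProper_of_injective_natAbs (S : SignedGraph V E) (f : V → ℤ)
    (hf : Function.Injective fun v => (f v).natAbs) : S.IsProper f := by
  intro e u v he h
  have h1 : (f u).natAbs = (f v).natAbs := by
    rw [h, Int.natAbs_mul, Int.units_natAbs, one_mul]
  have h2 : u = v := hf h1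
  apply S.loopless e
  rw [he, h2]
  exact rfl

theorem zeroFreeChoosable_card [Finite V] (S : SignedGraph V E) :
    S.ZeroFreeChoosable (Nat.card V) := by
  classical
  have := Fintype.ofFinite V
  intro L _ hL
  have hT : ∀ v, ∃ T : Finset ℤ, (T : Set ℤ) ⊆ L v ∧ T.card = 2 * Nat.card V := by
    intro v
    obtain ⟨t, ht, hc⟩ := Set.exists_subset_encard_eq (hL v)
    have hfin : t.Finite := Set.finite_of_encard_eq_coe hc
    refine ⟨hfin.toFinset, by simpa using ht, ?_⟩
    rw [hfin.encard_eq_coe_toFinset_card] at hc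
    exact_mod_cast hc
  choose T hTL hTc using hT
  have hA : ∀ v, Nat.card V ≤ ((T v).image Int.natAbs).card := by
    intro v
    have h : (T v).card ≤ 2 * ((T v).image Int.natAbs).card := by
      refine Finset.card_le_mul_card_image (T v) 2 ?_
      intro b _
      have hsub : (T v).filter (fun a => a.natAbs = b) ⊆ {(b : ℤ), -(b : ℤ)} := by
        intro a ha
        have := (Finset.mem_filter.1 ha).2
        simp only [Finset.mem_insert, Finset.mem_singleton]
        omega
      exact (Finset.card_le_card hsub).trans Finset.card_le_two
    rw [hTc] at h
    omega
  obtain ⟨g, hg, hgm⟩ := (Finset.all_card_le_biUnion_card_iff_exists_injective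
      (fun v => (T v).image Int.natAbs)).1 (by
    intro s
    rcases s.eq_empty_or_nonempty with rfl | ⟨v, hv⟩
    · simp
    · calc s.card ≤ Nat.card V := by
            rw [Nat.card_eq_fintype_card]; exact Finset.card_le_univ s
        _ ≤ _ := hA v
        _ ≤ _ := Finset.card_le_card
            (Finset.subset_biUnion_of_mem (fun v => (T v).image Int.natAbs) hv))
  have hf : ∀ v, ∃ c ∈ T v, c.natAbs = g v := fun v => Finset.mem_image.1 (hgm v)
  choose f hfT hfg using hf
  refine ⟨f, S.isProper_of_injective_natAbs f ?_, fun v => hTL v (hfT v)⟩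
  have : (fun v => (f v).natAbs) = g := funext hfg
  rw [this]
  exact hg

theorem zeroFreeColorable_card [Finite V] (S : SignedGraph V E) :
    S.ZeroFreeColorable (Nat.card V) := by
  refine ⟨fun v => ((Finite.equivFin V v : ℕ) : ℤ) + 1, S.isProper_of_injective_natAbs _ ?_, ?_⟩
  · intro u v h
    apply (Finite.equivFin V).injective
    apply Fin.ext
    simp only at h
    omega
  · intro v
    have := (Finite.equivFin V v).isLt
    change ((Finite.equivFin V v : ℕ) : ℤ) + 1 ≠ 0 ∧
      |((Finite.equivFin V v : ℕ) : ℤ) + 1| ≤ (Nat.card V : ℤ)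
    rw [abs_le]
    omega

theorem isLeast_zeroFreeChromaticNumber [Finite V] (S : SignedGraph V E) :
    IsLeast {m : ℕ | ∃ k : ℕ, m = 2 * k ∧ S.ZeroFreeColorable k} S.zeroFreeChromaticNumber :=
  ⟨Nat.sInf_mem ⟨_, _, rfl, S.zeroFreeColorable_card⟩, fun _ h => Nat.sInf_le h⟩

theorem isLeast_zeroFreeListChromaticNumber [Finite V] (S : SignedGraph V E) :
    IsLeast {m : ℕ | ∃ k : ℕ, m = 2 * k ∧ S.ZeroFreeChoosable k}
      S.zeroFreeListChromaticNumber :=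
  ⟨Nat.sInf_mem ⟨_, _, rfl, S.zeroFreeChoosable_card⟩, fun _ h => Nat.sInf_le h⟩

end SignedGraph

/-! Write `χ* = 2k` and fix a proper colouring `f₀` with values in `{±1, …, ±k}`. The absolute
values of `f₀` split the vertices into at most `k` parts. A list colour `c` at `v` is recorded as
the pair formed by `|c|` and the sign of `c * f₀ v`. If any two vertices that receive the same `|c|`
lie in one part and have the same recorded sign, the colouring is proper: a violation along an edge
would also be one for `f₀` (`sign_relation`). It remains to colour `k` parts with at most `2k+1`
vertices from lists of `2k` pairs (`colorableOn_univ`). When lists contain both signs of each of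
their colours this is Ohba's conjecture, and the argument is in the manner of Noel, Reed and Wu,
with a colour counted by the number `wt` (0, 1 or 2) of its signs in a list.

In a minimal counterexample, Hall's theorem matches the colours to distinct vertices, so there are
`m ≤ 2k` colours. For every set `F` of `k` colours there is a near acceptable map
(`exists_nearAcceptable`): its classes are coloured correctly, except for single vertices carrying
colours of `F`. It can be made surjective. Its classes cannot be matched to available colours, and a
Hall violator yields a set `N` of at least `k` colours that misses a colour of `F` and outside which
every colour is rare (`exists_certificate`).

Frequent colours therefore lie in every such `N`. If `F` can be chosen frequent, this is a
contradiction. Otherwise frequent colours and lone vertices are few; `F` is completed by the colours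
heaviest on lone vertices, and two double counts of the lists are numerically incompatible. -/

namespace SignedListColoring

/-! ### Numerical inequalities for the final count -/

theorem ineq_small (s γ y k p : ℤ) (hs : 1 ≤ s) (hγ : 1 ≤ γ) (hy : 0 ≤ y) (hpγ : p ≤ γ - 1)
  (hE : s * (s - p - γ) ≤ y * p) (hD : k * γ + y * (k + 1 - γ - y) ≤ (k - s) * s) (hk : k ≤ 2 * s - 1) (hys : y < s - γ) : False := by
  -- `hD` reads `k * (s - γ - y) ≥ s^2 - y * (γ + y - 1)`; the factor of `k` is positive, so `k` may
  -- be raised to `2 * s - 1`.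
  have h1 : (2*s-1)*(s-γ-y) ≥ s^2 - y*(γ+y-1) := by nlinarith
  have h2 : s^2 ≤ s*γ + (γ-1)*(s+y) := by nlinarith
  have h3 : s + y * (2*s - y - 2*γ+2) ≤ 0 := by nlinarith
  have : 0 ≤ y * (2*s - y - 2*γ+2) := mul_nonneg hy (by linarith)
  linarith

/-- Here the factor of `k` in `hD` has the other sign, so the lower bound `k ≥ p + γ + y` is
inserted (`hD'`). Eliminating `p` by `hE` leaves a polynomial inequality in `a = s - γ`, whose
critical side is at most its value at the bound `s(s+y)/(2s+y)` from `h1'`. This forces `y^2 ≥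
2s^2`, against `h3`. -/
theorem ineq_large (s γ y k p : ℤ) (hs : 1 ≤ s) (hγ : 1 ≤ γ) (hy : 0 ≤ y) (hp : 0 ≤ p) (hpγ : p ≤ γ - 1)
  (hpx : p ≤ k - γ - y)
  (hE : s * (s - p - γ) ≤ y * p) (hD : k * γ + y * (k + 1 - γ - y) ≤ (k - s) * s) (hk : k ≤ 2 * s - 1) (hys : s - γ ≤ y) : False := by
  obtain ⟨a, rfl⟩ : ∃ a, γ = s - a := ⟨s - γ, by ring⟩
  have hE' : s * a ≤ p * (s + y) := by nlinarith
  have ha : 0 < a := by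
    by_contra h
    nlinarith [mul_nonneg hy hp]
  have hD' : 0 ≤ p * (a - y) + (s - a + y) * a - s^2 - y := by nlinarith
  have hq : p + y ≤ s - 1 + a := by linarith
  have h1 : a * (2*s+y) ≤ (s-1)*(s+y) := by nlinarith
  have h1' : a * (2*s+y) < s*(s+y) := by nlinarith
  have h2 : y*(s+y) ≤ (s-1)*(s+y) + a*y := by nlinarith
  have h3 : y^2 < 2*s^2 := by
    have : y*(s+y)*(2*s+y) < (s*(s+y) + 0)*(2*s+y) + s*(s+y)*y := by nlinarith
    have : (s+y) * (y*(2*s+y)) < (s+y) * (s*(2*s+y) + s*y) := by nlinarith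
    have := lt_of_mul_lt_mul_left this (by linarith)
    nlinarith
  have h4 : s^3 + y*s^2+s*y+y^2 ≤ a*(s^2+s*y+y^2) - a^2*y := by
    have : (p*(s+y)) * (y - a) ≥ s*a*(y-a) := by
      apply mul_le_mul_of_nonneg_right hE'; linarith
    nlinarith
  have h5 : (2*s+y)^2 * (a*(s^2+s*y+y^2) - a^2*y) ≤ (2*s+y)*(s*(s+y))*(s^2+s*y+y^2) - (s*(s+y))^2*y := by
    set A := a*(2*s+y)
    set B := s*(s+y)
    have e : (2*s+y)^2 * (a*(s^2+s*y+y^2) - a^2*y) = (2*s+y)*A*(s^2+s*y+y^2) - A^2*y := by simp only [A]; ring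
    rw [e]
    have : 0 ≤ (B - A) * ((2*s+y)*(s^2+s*y+y^2) - (A+B)*y) := by
      apply mul_nonneg
      · linarith
      · have : A + B ≤ 2*B := by linarith
        have : (A+B)*y ≤ 2*B*y := mul_le_mul_of_nonneg_right this hy
        have : 2*B*y ≤ (2*s+y)*(s^2+s*y+y^2) := by
          simp only [B]; nlinarith [mul_nonneg hy hy, mul_nonneg (mul_nonneg hy hy) hy, mul_nonneg (mul_nonneg hy hy) (by linarith : (0:ℤ) ≤ s), mul_nonneg hy (sq_nonneg s), pow_pos (by linarith : (0:ℤ) < s) 3]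
        linarith
    nlinarith
  have h6 : (2*s+y)^2*(s^3 + y*s^2+s*y+y^2) ≤ (2*s+y)*(s*(s+y))*(s^2+s*y+y^2) - (s*(s+y))^2*y := 
    (mul_le_mul_of_nonneg_left h4 (sq_nonneg _)).trans h5
  have h7 : (s+y) * ((2*s+y)^2*(s^2)) ≤ (s+y)*(s*((2*s+y)*(s^2+s*y+y^2) - s*(s+y)*y)) := by
    nlinarith [mul_nonneg (sq_nonneg (2*s+y)) (mul_nonneg hy (by linarith : (0:ℤ) ≤ s+y))]
  have h8 := le_of_mul_le_mul_left h7 (by linarith)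
  have h9 : s * (s*(2*s+y)^2) ≤ s*((2*s+y)*(s^2+s*y+y^2) - s*(s+y)*y) := by nlinarith
  have h10 : s*(2*s+y)^2 ≤ (2*s+y)*(s^2+s*y+y^2) - s*(s+y)*y := by
    refine le_of_mul_le_mul_left ?_ (by linarith : 0 < s)
    linarith
  have h11 : 0 ≤ (s+y)*(y^2-2*s^2) := by nlinarith
  nlinarith

open Finset
open scoped Classical

/-! ### Lists of signed colours and their weights -/

section Basic

variable {V ι α : Type*}

/-- `f` picks for every vertex of `X` a pair (colour, sign) from its list, and two vertices with
the same colour lie in the same part and get the same sign. -/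
def IsColoringOn (part : V → ι) (X : Finset V) (L : V → Finset (α × Bool)) (f : V → α × Bool) :
    Prop :=
  (∀ v ∈ X, f v ∈ L v) ∧
    ∀ u ∈ X, ∀ v ∈ X, (f u).1 = (f v).1 → part u = part v ∧ (f u).2 = (f v).2

def ColorableOn (part : V → ι) (X : Finset V) (L : V → Finset (α × Bool)) : Prop :=
  ∃ f, IsColoringOn part X L f

theorem IsColoringOn.union {part : V → ι} {X Y : Finset V} {L : V → Finset (α × Bool)}
    {f g : V → α × Bool} (hf : IsColoringOn part X L f) (hg : IsColoringOn part Y L g)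
    (hfg : ∀ u ∈ X, ∀ v ∈ Y, (f u).1 ≠ (g v).1) :
    IsColoringOn part (X ∪ Y) L (fun v => if v ∈ X then f v else g v) := by
  refine ⟨fun v hv => ?_, fun u hu v hv huv => ?_⟩
  · by_cases h : v ∈ X
    · simpa [h] using hf.1 v h
    · simpa [h] using hg.1 v ((mem_union.1 hv).resolve_left h)
  · by_cases h : u ∈ X <;> by_cases h' : v ∈ X <;> simp only [h, h', if_true, if_false] at huv ⊢
    · exact hf.2 u h v h' huv
    · exact absurd huv (hfg u h v ((mem_union.1 hv).resolve_left h'))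
    · exact absurd huv.symm (hfg v h' u ((mem_union.1 hu).resolve_left h))
    · exact hg.2 u ((mem_union.1 hu).resolve_left h) v ((mem_union.1 hv).resolve_left h') huv

theorem IsColoringOn.mono_list {part : V → ι} {X : Finset V} {L L' : V → Finset (α × Bool)}
    {f : V → α × Bool} (hf : IsColoringOn part X L f) (h : ∀ v ∈ X, L v ⊆ L' v) :
    IsColoringOn part X L' f :=
  ⟨fun v hv => h v hv (hf.1 v hv), hf.2⟩

/-- Hall's theorem for a subfamily indexed by a finset. -/
theorem exists_injOn_of_hall {β γ : Type*} [Nonempty γ] (D : Finset β) (t : β → Finset γ)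
    (h : ∀ E ⊆ D, E.card ≤ (E.biUnion t).card) :
    ∃ f : β → γ, Set.InjOn f D ∧ ∀ a ∈ D, f a ∈ t a := by
  obtain ⟨g, hg, hgt⟩ := (Finset.all_card_le_biUnion_card_iff_exists_injective
    (fun a : {a // a ∈ D} => t a)).1 (by
      intro s
      have := h (s.map (Function.Embedding.subtype _)) (by
        intro a ha
        obtain ⟨b, -, rfl⟩ := mem_map.1 ha
        exact b.2)
      rw [card_map] at this
      refine this.trans (card_le_card ?_)
      intro c hc
      simp only [mem_biUnion, mem_map, Function.Embedding.coe_subtype] at hc ⊢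
      obtain ⟨_, ⟨b, hb, rfl⟩, hc⟩ := hc
      exact ⟨b, hb, hc⟩)
  refine ⟨fun a => if ha : a ∈ D then g ⟨a, ha⟩ else Classical.arbitrary γ, ?_, ?_⟩
  · intro a ha b hb hab
    simp only [mem_coe] at ha hb
    simp only [ha, hb, dif_pos] at hab
    exact congrArg Subtype.val (hg hab)
  · intro a ha
    simp only [ha, dif_pos]
    exact hgt ⟨a, ha⟩

/-- The number of signs with which the colour `c` occurs in the list of `v`. -/
noncomputable def wt (L : V → Finset (α × Bool)) (v : V) (c : α) : ℕ :=
  (univ.filter fun s : Bool => (c, s) ∈ L v).card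

theorem wt_le_two (L : V → Finset (α × Bool)) (v : V) (c : α) : wt L v c ≤ 2 :=
  (card_le_univ _).trans (by simp)

theorem wt_eq_zero_iff {L : V → Finset (α × Bool)} {v : V} {c : α} :
    wt L v c = 0 ↔ ∀ s, (c, s) ∉ L v := by
  simp [wt, filter_eq_empty_iff]

theorem wt_pos_iff {L : V → Finset (α × Bool)} {v : V} {c : α} :
    0 < wt L v c ↔ ∃ s, (c, s) ∈ L v := by
  rw [Nat.pos_iff_ne_zero, Ne, wt_eq_zero_iff]; push Not; rfl

theorem sum_wt_eq (L : V → Finset (α × Bool)) (v : V) (C : Finset α) :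
    ∑ c ∈ C, wt L v c = ((L v).filter fun x => x.1 ∈ C).card := by
  simp only [wt, card_filter]
  rw [← sum_product' (s := C) (t := univ) (f := fun c s => if (c, s) ∈ L v then 1 else 0),
    ← card_filter, ← card_filter]
  congr 1
  ext ⟨c, s⟩
  simp [and_comm]

theorem sum_wt_vertices (L : V → Finset (α × Bool)) (Z : Finset V) (c : α) :
    ∑ v ∈ Z, wt L v c =
      (Z.filter fun v => (c, true) ∈ L v).card + (Z.filter fun v => (c, false) ∈ L v).card := by
  simp only [wt, card_filter, Fintype.sum_bool, sum_add_distrib]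

theorem card_le_card_filter_color_add (L : V → Finset (α × Bool)) (v : V) (C : Finset α) :
    (L v).card ≤ ((L v).filter fun x => x.1 ∉ C).card + 2 * C.card := by
  have h1 := card_filter_add_card_filter_not (s := L v) (fun x => x.1 ∈ C)
  have h2 : ((L v).filter fun x => x.1 ∈ C).card ≤ 2 * C.card := by
    rw [← sum_wt_eq]
    calc _ ≤ ∑ c ∈ C, 2 := sum_le_sum fun c _ => wt_le_two L v c
      _ = _ := by simp [mul_comm]
  omega

/-- The fibre of `c` under `f`. -/
noncomputable def cls {β : Type*} [Fintype V] (f : V → β) (c : β) : Finset V :=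
  univ.filter fun v => f v = c

theorem mem_cls {β : Type*} [Fintype V] {f : V → β} {c : β} {v : V} : v ∈ cls f c ↔ f v = c := by
  simp [cls]

/-- The vertices that are alone in their part. -/
noncomputable def lone [Fintype V] (part : V → ι) : Finset V :=
  univ.filter fun v => ∀ u, part u = part v → u = v

theorem mem_lone [Fintype V] {part : V → ι} {v : V} :
    v ∈ lone part ↔ ∀ u, part u = part v → u = v := by
  simp [lone]

variable [Fintype α]

theorem sum_wt_univ (L : V → Finset (α × Bool)) (v : V) : ∑ c, wt L v c = (L v).card := by
  rw [sum_wt_eq]; simp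

/-- The colours that occur with a common sign in all lists of the vertices of `Z`. -/
noncomputable def avail (L : V → Finset (α × Bool)) (Z : Finset V) : Finset α :=
  univ.filter fun c => ∃ s, ∀ u ∈ Z, (c, s) ∈ L u

theorem mem_avail {L : V → Finset (α × Bool)} {Z : Finset V} {c : α} :
    c ∈ avail L Z ↔ ∃ s, ∀ u ∈ Z, (c, s) ∈ L u := by
  simp [avail]

theorem avail_anti (L : V → Finset (α × Bool)) {Z Z' : Finset V} (h : Z ⊆ Z') :
    avail L Z' ⊆ avail L Z := by
  intro c hc
  obtain ⟨s, hs⟩ := mem_avail.1 hc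
  exact mem_avail.2 ⟨s, fun u hu => hs u (h hu)⟩

theorem mem_avail_singleton {L : V → Finset (α × Bool)} {v : V} {c : α} :
    c ∈ avail L {v} ↔ 0 < wt L v c := by
  simp [mem_avail, wt_pos_iff]

/-- Each of the two signs of `c` is missing from some list on `Z`. This loss of 2 drives most of the
counting below. -/
theorem sum_wt_add_two_le {L : V → Finset (α × Bool)} {Z : Finset V} {c : α}
    (hc : c ∉ avail L Z) : ∑ v ∈ Z, wt L v c + 2 ≤ 2 * Z.card := by
  rw [sum_wt_vertices]
  have key : ∀ s, (Z.filter fun v => (c, s) ∈ L v).card < Z.card := by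
    intro s
    refine card_lt_card (filter_ssubset.2 ?_)
    by_contra! h
    exact hc (mem_avail.2 ⟨s, h⟩)
  have h1 := key true
  have h2 := key false
  omega

theorem card_le_two_mul_avail_singleton (L : V → Finset (α × Bool)) (v : V) :
    (L v).card ≤ 2 * (avail L {v}).card := by
  rw [← sum_wt_univ L v, ← sum_subset (subset_univ (avail L {v}))]
  · calc _ ≤ ∑ c ∈ avail L {v}, 2 := sum_le_sum fun c _ => wt_le_two L v c
      _ = _ := by simp [mul_comm]
  · intro c _ hc
    rw [mem_avail_singleton] at hc
    omega

/-- Classes of a map to colours that are matched to distinct available colours give a colouring. -/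
theorem isColoringOn_of_classes {part : V → ι} {L : V → Finset (α × Bool)} {β : Type*}
    {f : V → β} {X : Finset V} (hf : ∀ u ∈ X, ∀ v ∈ X, f u = f v → part u = part v) {h : β → α}
    {Y : Finset β} (hX : ∀ v ∈ X, f v ∈ Y) (hh : Set.InjOn h Y)
    (ha : ∀ c ∈ Y, h c ∈ avail L (X.filter fun v => f v = c)) :
    ∃ g : V → α × Bool, IsColoringOn part X L g ∧ ∀ v ∈ X, (g v).1 = h (f v) := by
  have : ∀ c, ∃ s, c ∈ Y → ∀ u ∈ X.filter (fun v => f v = c), (h c, s) ∈ L u := by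
    intro c
    by_cases hc : c ∈ Y
    · obtain ⟨s, hs⟩ := mem_avail.1 (ha c hc)
      exact ⟨s, fun _ => hs⟩
    · exact ⟨true, fun h => absurd h hc⟩
  choose s hs using this
  refine ⟨fun v => (h (f v), s (f v)), ⟨fun v hv => ?_, fun u hu v hv huv => ?_⟩, fun _ _ => rfl⟩
  · exact hs (f v) (hX v hv) v (mem_filter.2 ⟨hv, rfl⟩)
  · have := hh (hX u hu) (hX v hv) huv
    exact ⟨hf u hu v hv this, by simp only [this]⟩

/-- A list assignment with `k` parts and `2 * k + 1` vertices that has no colouring, while all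
smaller ones have. -/
structure Critical [Fintype V] (part : V → ι) (L : V → Finset (α × Bool)) (k : ℕ) : Prop where
  card_parts : (univ.image part).card = k
  card_vert : Fintype.card V = 2 * k + 1
  card_list : ∀ v, (L v).card = 2 * k
  appears : ∀ c, ∃ v, 0 < wt L v c
  not_colorable : ¬ ColorableOn part univ L
  colorable_of_lt : ∀ (X : Finset V) (L' : V → Finset (α × Bool)) (k' : ℕ), k' < k →
    (X.image part).card ≤ k' → X.card ≤ 2 * k' + 1 → (∀ v ∈ X, 2 * k' ≤ (L' v).card) →
    ColorableOn part X L'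
  colorable_of_ne_univ : ∀ (X : Finset V) (L' : V → Finset (α × Bool)), X ≠ univ →
    (∀ v ∈ X, 2 * k ≤ (L' v).card) → ColorableOn part X L'

/-! ### Minimal counterexamples -/

namespace Critical

variable [Fintype V] {part : V → ι} {L : V → Finset (α × Bool)} {k : ℕ}

omit [Fintype α] in
theorem nonempty_vert (H : Critical part L k) : Nonempty V :=
  Fintype.card_pos_iff.1 (by rw [H.card_vert]; omega)

omit [Fintype α] in
theorem pos (H : Critical part L k) : 0 < k := by
  obtain ⟨v⟩ := H.nonempty_vert
  rw [← H.card_parts, card_pos]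
  exact ⟨part v, by simp⟩

omit [Fintype α] in
theorem nonempty_colors (H : Critical part L k) : Nonempty α := by
  obtain ⟨v⟩ := H.nonempty_vert
  have := H.card_list v
  have := H.pos
  obtain ⟨x, _⟩ := card_pos.1 (show 0 < (L v).card by omega)
  exact ⟨x.1⟩

theorem le_card_avail_singleton (H : Critical part L k) (v : V) : k ≤ (avail L {v}).card := by
  have := card_le_two_mul_avail_singleton L v
  rw [H.card_list] at this
  omega

/-- The colours can be matched to distinct vertices whose lists contain them. -/
theorem exists_matching (H : Critical part L k) :
    ∃ M : α → V, Function.Injective M ∧ ∀ c, 0 < wt L (M c) c := by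
  have := H.nonempty_vert
  let t : α → Finset V := fun c => univ.filter fun v => 0 < wt L v c
  by_cases hall : ∀ E : Finset α, E.card ≤ (E.biUnion t).card
  · obtain ⟨M, hM, hMt⟩ := exists_injOn_of_hall univ t fun E _ => hall E
    exact ⟨M, fun a b h => hM (by simp) (by simp) h, fun c => by simpa [t] using hMt c (mem_univ c)⟩
  exfalso
  push Not at hall
  obtain ⟨D₀, hD₀⟩ := hall
  obtain ⟨D, hD, hmin⟩ := exists_min_image
    (univ.filter fun D : Finset α => (D.biUnion t).card < D.card) card ⟨D₀, by simpa using hD₀⟩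
  simp only [mem_filter, mem_univ, true_and] at hD hmin
  obtain ⟨d, hd⟩ : D.Nonempty := card_pos.1 (by omega)
  -- By minimality `D` without `d` satisfies Hall's condition, and its matching exhausts the
  -- vertices that see `D`. These take their matched colours; the other vertices have lists avoiding
  -- `D` and are coloured by criticality.
  obtain ⟨g, hg, hgt⟩ := exists_injOn_of_hall (D.erase d) t (by
    intro E hE
    by_contra! h
    have h1 := hmin E h
    have h2 := card_le_card hE
    rw [card_erase_of_mem hd] at h2
    have := card_pos.2 ⟨d, hd⟩
    omega)
  have himg : (D.erase d).image g = D.biUnion t := by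
    refine eq_of_subset_of_card_le ?_ ?_
    · intro v hv
      obtain ⟨c, hc, rfl⟩ := mem_image.1 hv
      exact mem_biUnion.2 ⟨c, mem_of_mem_erase hc, hgt c hc⟩
    · rw [card_image_of_injOn hg, card_erase_of_mem hd]
      omega
  have hinv : ∀ v, ∃ c, v ∈ D.biUnion t → c ∈ D.erase d ∧ g c = v := by
    intro v
    by_cases hv : v ∈ D.biUnion t
    · rw [← himg] at hv
      obtain ⟨c, hc, hcv⟩ := mem_image.1 hv
      exact ⟨c, fun _ => ⟨hc, hcv⟩⟩
    · exact ⟨d, fun h => absurd h hv⟩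
  choose c hc using hinv
  obtain ⟨f₁, hf₁, hf₁c⟩ := isColoringOn_of_classes (part := part) (L := L) (X := D.biUnion t)
    (f := id) (h := c) (Y := D.biUnion t) (fun u _ v _ h => by simp only [id] at h; rw [h])
    (fun v hv => hv) (fun u hu v hv h => by rw [← (hc u hu).2, ← (hc v hv).2, h]) (by
      intro v hv
      refine avail_anti L (Z' := {v}) (fun u hu => by simpa using (mem_filter.1 hu).2) ?_
      rw [mem_avail_singleton]
      have := hgt _ (hc v hv).1
      rw [(hc v hv).2] at this
      simpa [t] using this)
  obtain ⟨f₂, hf₂⟩ := H.colorable_of_ne_univ (D.biUnion t)ᶜ L (by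
      intro h
      obtain ⟨v, hv⟩ := H.appears d
      have : v ∈ (D.biUnion t)ᶜ := by rw [h]; simp
      exact (mem_compl.1 this) (mem_biUnion.2 ⟨d, hd, by simpa [t] using hv⟩))
    (fun v _ => (H.card_list v).ge)
  have := hf₁.union hf₂ (by
    intro u hu v hv huv
    rw [hf₁c u hu] at huv
    refine (mem_compl.1 hv) (mem_biUnion.2 ⟨c u, mem_of_mem_erase (hc u hu).1, ?_⟩)
    have := hf₂.1 v hv
    simp only [t, mem_filter, mem_univ, true_and, wt_pos_iff]
    exact ⟨(f₂ v).2, by rw [show c u = (f₂ v).1 from huv]; exact this⟩)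
  rw [union_compl] at this
  exact H.not_colorable ⟨_, this⟩

/-- With more colours the matching would be onto the vertices, and its inverse would give a
colouring. -/
theorem card_colors_le (H : Critical part L k) : Fintype.card α ≤ 2 * k := by
  obtain ⟨M, hM, hMw⟩ := H.exists_matching
  have h1 := Fintype.card_le_of_injective M hM
  rw [H.card_vert] at h1
  by_contra! h2
  have hb : Function.Bijective M := (Fintype.bijective_iff_injective_and_card M).2
    ⟨hM, by rw [H.card_vert]; omega⟩
  let e := Equiv.ofBijective M hb
  obtain ⟨f, hf, -⟩ := isColoringOn_of_classes (part := part) (L := L) (X := univ)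
    (f := id) (h := e.symm) (Y := univ) (fun u _ v _ h => by simp only [id] at h; rw [h])
    (fun v hv => hv) (e.symm.injective.injOn) (by
      intro v hv
      refine avail_anti L (Z' := {v}) (fun u hu => by simpa using (mem_filter.1 hu).2) ?_
      rw [mem_avail_singleton]
      have := hMw (e.symm v)
      rwa [show M (e.symm v) = v from e.apply_symm_apply v] at this)
  exact H.not_colorable ⟨f, hf⟩

/-- No colour occurs with a common sign in all lists of a part with at least two vertices. -/
theorem not_mem_avail_part (H : Critical part L k) (j : ι)
    (hj : 2 ≤ (cls part j).card) (c : α) :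
    c ∉ avail L (cls part j) := by
  intro hc
  obtain ⟨s, hs⟩ := mem_avail.1 hc
  set P := cls part j with hP
  have hk := H.pos
  -- One colour would serve the whole part; deleting it costs each list at most two pairs, so the
  -- rest falls under the case `k - 1`.
  obtain ⟨f, hf⟩ := H.colorable_of_lt Pᶜ (fun v => (L v).filter fun x => x.1 ∉ ({c} : Finset α))
    (k - 1) (by omega)
    (by
      obtain ⟨v, hv⟩ := card_pos.1 (show 0 < P.card by omega)
      have : (Pᶜ.image part) ⊆ (univ.image part).erase j := by
        intro i hi
        obtain ⟨u, hu, rfl⟩ := mem_image.1 hi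
        simp only [hP, mem_compl, mem_cls] at hu
        simp [hu]
      refine (card_le_card this).trans ?_
      rw [card_erase_of_mem, H.card_parts]
      exact mem_image.2 ⟨v, mem_univ v, mem_cls.1 hv⟩)
    (by rw [card_compl, H.card_vert]; omega)
    (fun v _ => by
      have h1 := card_le_card_filter_color_add L v {c}
      rw [H.card_list, card_singleton] at h1
      omega)
  have hconst : IsColoringOn part P L (fun _ => (c, s)) :=
    ⟨hs, fun u hu v hv _ => ⟨(mem_cls.1 hu).trans (mem_cls.1 hv).symm, rfl⟩⟩
  have := hconst.union (hf.mono_list fun v _ => filter_subset _ _) (by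
    intro u _ v hv h
    have := (mem_filter.1 (hf.1 v hv)).2
    simp only [mem_singleton] at this
    exact this h.symm)
  rw [union_compl] at this
  exact H.not_colorable ⟨_, this⟩

end Critical

end Basic

/-! ### Near acceptable maps and Hall violators -/

section Finite

variable {V ι α : Type*} [Fintype α] [Fintype V]

/-- The classes of `f` lie inside parts, and each is acceptable by its own colour or is a single
vertex whose colour belongs to `F`. -/
def NearAcceptable (part : V → ι) (L : V → Finset (α × Bool)) (F : Finset α) (f : V → α) : Prop :=
  (∀ u v, f u = f v → part u = part v) ∧
    ∀ c, c ∈ avail L (cls f c) ∨ ((cls f c).card ≤ 1 ∧ c ∈ F)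

namespace Critical

variable {part : V → ι} {L : V → Finset (α × Bool)} {k : ℕ}

/-- Take a near acceptable map that agrees with the matching `M` at as many colours as possible. If
`d` were unused, moving `M d` to `d` would create an acceptable singleton, only shrink the other
classes, and gain an agreement. -/
theorem exists_surjective_nearAcceptable (H : Critical part L k) {F : Finset α} {f₀ : V → α}
    (hf₀ : NearAcceptable part L F f₀) :
    ∃ f, NearAcceptable part L F f ∧ Function.Surjective f := by
  obtain ⟨M, hM, hMw⟩ := H.exists_matching
  obtain ⟨f, hf, hmax⟩ := exists_max_image (univ.filter fun f : V → α => NearAcceptable part L F f)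
    (fun f => (univ.filter fun c => f (M c) = c).card) ⟨f₀, by simpa using hf₀⟩
  simp only [mem_filter, mem_univ, true_and] at hf hmax
  refine ⟨f, hf, ?_⟩
  by_contra hs
  simp only [Function.Surjective, not_forall, not_exists] at hs
  obtain ⟨d, hd⟩ := hs
  have hupd : ∀ u, Function.update f (M d) d u = if u = M d then d else f u :=
    fun u => Function.update_apply _ _ _ _
  have hd' : cls (Function.update f (M d) d) d = {M d} := by
    ext u
    rw [mem_cls, hupd, mem_singleton]
    by_cases h : u = M d <;> simp [h, hd u]
  have hsub : ∀ c, c ≠ d → cls (Function.update f (M d) d) c ⊆ cls f c := by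
    intro c hc u hu
    rw [mem_cls, hupd] at hu
    rw [mem_cls]
    split_ifs at hu with h
    · exact absurd hu.symm hc
    · exact hu
  have hna : NearAcceptable part L F (Function.update f (M d) d) := by
    refine ⟨fun u v huv => ?_, fun c => ?_⟩
    · rw [hupd, hupd] at huv
      split_ifs at huv with h1 h2 h2
      · rw [h1, h2]
      · exact absurd huv.symm (hd v)
      · exact absurd huv (hd u)
      · exact hf.1 u v huv
    · by_cases hc : c = d
      · subst hc
        left
        rw [hd', mem_avail_singleton]
        exact hMw c
      · rcases hf.2 c with h | ⟨h, h'⟩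
        · exact Or.inl (avail_anti L (hsub c hc) h)
        · exact Or.inr ⟨(card_le_card (hsub c hc)).trans h, h'⟩
  refine absurd (hmax _ hna) (not_le.2 (card_lt_card ?_))
  rw [ssubset_iff_of_subset]
  · exact ⟨d, by simp, by simp [hd]⟩
  · intro c hc
    simp only [mem_filter, mem_univ, true_and, hupd] at hc ⊢
    split_ifs with h
    · exact (hM h).symm
    · exact hc

/-- A Hall violator of maximal deficiency for the classes of a surjective near acceptable map. -/
theorem exists_violator (H : Critical part L k) {F : Finset α} {f : V → α}
    (hf : NearAcceptable part L F f) (hs : Function.Surjective f) :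
    ∃ S : Finset α, (S.biUnion fun c => avail L (cls f c)).card < S.card ∧
      (∃ h : α → α, Set.InjOn h (Sᶜ : Finset α) ∧
        ∀ c ∈ Sᶜ, h c ∈ avail L (cls f c) \ S.biUnion fun c => avail L (cls f c)) ∧
      (∃ c₀ ∈ F, c₀ ∉ S.biUnion fun c => avail L (cls f c)) ∧
      k ≤ (S.biUnion fun c => avail L (cls f c)).card := by
  have := H.nonempty_colors
  set t : α → Finset α := fun c => avail L (cls f c) with ht
  obtain ⟨S, -, hmax⟩ := exists_max_image (univ : Finset (Finset α))
    (fun S => (S.card : ℤ) - (S.biUnion t).card) univ_nonempty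
  have hmax' : ∀ S' : Finset α, (S'.card : ℤ) - (S'.biUnion t).card ≤
    (S.card : ℤ) - (S.biUnion t).card := fun S' => hmax S' (mem_univ _)
  have hdef : (S.biUnion t).card < S.card := by
    by_contra! hle
    obtain ⟨h, hh, hht⟩ := exists_injOn_of_hall univ t (fun E _ => by
      have := hmax' E
      omega)
    obtain ⟨g, hg, -⟩ := isColoringOn_of_classes (L := L) (X := univ) (f := f) (Y := univ)
      (fun u _ v _ => hf.1 u v) (fun v _ => mem_univ _) hh hht
    exact H.not_colorable ⟨g, hg⟩
  refine ⟨S, hdef, ?_, ?_⟩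
  -- A violation of Hall's condition here could be added to `S`, raising its deficiency.
  · refine exists_injOn_of_hall Sᶜ _ fun E hE => ?_
    have h1 := hmax' (S ∪ E)
    have hdis : Disjoint S E := by
      rw [disjoint_comm]
      exact disjoint_left.2 fun a ha => mem_compl.1 (hE ha)
    rw [card_union_of_disjoint hdis] at h1
    have h2 : (S ∪ E).biUnion t = S.biUnion t ∪ E.biUnion (fun c => t c \ S.biUnion t) := by
      ext c
      simp only [mem_biUnion, mem_union, mem_sdiff]
      constructor
      · rintro ⟨a, ha | ha, hc⟩
        · exact Or.inl ⟨a, ha, hc⟩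
        · by_cases h : ∃ a ∈ S, c ∈ t a
          · exact Or.inl h
          · exact Or.inr ⟨a, ha, hc, h⟩
      · rintro (⟨a, ha, hc⟩ | ⟨a, ha, hc, -⟩)
        · exact ⟨a, Or.inl ha, hc⟩
        · exact ⟨a, Or.inr ha, hc⟩
    have h3 : ((S ∪ E).biUnion t).card ≤
        (S.biUnion t).card + (E.biUnion (fun c => t c \ S.biUnion t)).card := by
      rw [h2]; exact card_union_le _ _
    push_cast at h1
    change _ ≤ (E.biUnion fun c => t c \ S.biUnion t).card
    omega
  -- A colour of `S` outside the neighbourhood is not available on its own class, so that class is a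
  -- single vertex and the colour is in `F`. The list of this vertex alone contributes `k` colours
  -- to the neighbourhood.
  · obtain ⟨c₀, hc₀, hc₀N⟩ := exists_mem_notMem_of_card_lt_card hdef
    have hsub : t c₀ ⊆ S.biUnion t := subset_biUnion_of_mem t hc₀
    rcases hf.2 c₀ with h | ⟨h1, h2⟩
    · exact absurd (hsub h) hc₀N
    · refine ⟨⟨c₀, h2, hc₀N⟩, ?_⟩
      obtain ⟨v, hv⟩ := hs c₀
      have : cls f c₀ = {v} := by
        refine (eq_of_subset_of_card_le ?_ (by simpa using h1)).symm
        simpa [mem_cls] using hv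
      refine (H.le_card_avail_singleton v).trans (card_le_card ?_)
      rw [← this]
      exact hsub

/-- A near acceptable map yields a large set `N` of colours such that every other colour is rare. -/
theorem exists_certificate (H : Critical part L k) {F : Finset α} {f₀ : V → α}
    (hf₀ : NearAcceptable part L F f₀) :
    ∃ (N : Finset α) (P : Finset V), k ≤ N.card ∧ (∃ c ∈ F, c ∉ N) ∧ P ⊆ lone part ∧
      P.card + Fintype.card α ≤ 2 * k ∧ P.card + N.card + 1 ≤ Fintype.card α ∧
      (∀ c ∉ N, ∑ v, wt L v c + 2 * N.card ≤ 4 * k) ∧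
      ∀ v ∈ lone part, v ∉ P → ∀ c ∉ N, wt L v c = 0 := by
  obtain ⟨f, hf, hs⟩ := H.exists_surjective_nearAcceptable hf₀
  obtain ⟨S, hdef, ⟨h, hh, hht⟩, hc₀, hkN⟩ := H.exists_violator hf hs
  set N := S.biUnion fun c => avail L (cls f c) with hN
  have hNmem : ∀ c ∉ N, ∀ a ∈ S, c ∉ avail L (cls f a) := fun c hc a ha h =>
    hc (mem_biUnion.2 ⟨a, ha, h⟩)
  have hlone : ∀ v ∈ lone part, cls f (f v) = {v} := by
    intro v hv
    ext u
    rw [mem_cls, mem_singleton]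
    refine ⟨fun h => (mem_filter.1 hv).2 u (hf.1 u v h), fun h => by rw [h]⟩
  set P := (lone part).filter fun v => f v ∉ S with hP
  have hPS : P.card ≤ Sᶜ.card := by
    refine card_le_card_of_injOn f (fun v hv => ?_) (fun u hu v hv huv => ?_)
    · simpa using (mem_filter.1 hv).2
    · exact ((mem_filter.1 hv).1 |> fun h => (mem_filter.1 h).2) u (hf.1 u v huv)
  rw [card_compl] at hPS
  have hSle : S.card ≤ Fintype.card α := card_le_univ S
  have hsumcls : ∀ T : Finset α, ∑ c ∈ T, (cls f c).card = (univ.filter fun v => f v ∈ T).card := by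
    intro T
    rw [card_eq_sum_card_fiberwise (f := f) (t := T) (fun v hv => by simpa using hv)]
    refine sum_congr rfl fun c hc => ?_
    congr 1
    ext v
    simp only [cls, mem_filter, mem_univ, true_and]
    exact ⟨fun h => ⟨h ▸ hc, h⟩, fun h => h.2⟩
  have hclspos : ∀ c, 1 ≤ (cls f c).card := by
    intro c
    obtain ⟨v, hv⟩ := hs c
    exact card_pos.2 ⟨v, mem_cls.2 hv⟩
  refine ⟨N, P, hkN, hc₀, filter_subset _ _, ?_, by omega, ?_, ?_⟩
  -- Otherwise a colouring exists: classes in `U` keep their colours, classes outside `S` are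
  -- matched outside `N`, and `Q`, whose lists lie in `N`, is coloured without `U`. Surjectivity
  -- gives `|U| ≤ 2k + 1 - m ≤ |P|`, and `Q` avoids the parts of `P`, so `Q` has at most `k - |U|`
  -- parts and `2(k - |U|) + 1` vertices.
  · by_contra! hlt
    set U := S.filter fun c => 2 ≤ (cls f c).card with hU
    set Q := univ.filter fun v => f v ∈ S \ U with hQ
    have hUacc : ∀ c ∈ U, c ∈ avail L (cls f c) := by
      intro c hc
      have := (mem_filter.1 hc).2
      rcases hf.2 c with h | ⟨h, -⟩
      · exact h
      · omega
    have hUN : U ⊆ N := fun c hc => mem_biUnion.2 ⟨c, (mem_filter.1 hc).1, hUacc c hc⟩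
    have hUle : U.card + Fintype.card α ≤ 2 * k + 1 := by
      have h1 := hsumcls univ
      simp only [mem_univ, filter_true, card_univ, H.card_vert] at h1
      rw [← h1, card_eq_sum_ones, ← sum_filter_add_sum_filter_not univ (fun c => c ∈ U),
        ← card_univ, card_eq_sum_ones, ← sum_filter_add_sum_filter_not univ (fun c => c ∈ U),
        ← add_assoc]
      rw [filter_mem_eq_inter, univ_inter, ← sum_add_distrib]
      refine add_le_add (sum_le_sum fun c hc => (mem_filter.1 hc).2) (sum_le_sum fun c _ => hclspos c)
    have hQU : Q.card + 2 * U.card ≤ 2 * k + 1 := by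
      have h1 := hsumcls U
      have h2 : 2 * U.card ≤ ∑ c ∈ U, (cls f c).card := by
        rw [card_eq_sum_ones, mul_sum]
        exact sum_le_sum fun c hc => (mem_filter.1 hc).2
      have h3 : Q.card + (univ.filter fun v => f v ∈ U).card ≤ Fintype.card V := by
        rw [← card_union_of_disjoint]
        · exact card_le_univ _
        · rw [disjoint_left]
          intro v hv hv'
          simp only [hQ, mem_filter, mem_sdiff] at hv hv'
          exact hv.2.2 hv'.2
      rw [H.card_vert] at h3
      omega
    have hQN : ∀ v ∈ Q, ∀ x ∈ L v, x.1 ∈ N := by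
      intro v hv x hx
      simp only [hQ, hU, mem_filter, mem_sdiff, mem_univ, true_and, not_and, not_le] at hv
      refine mem_biUnion.2 ⟨f v, hv.1, mem_avail.2 ⟨x.2, fun u hu => ?_⟩⟩
      have h2 := hv.2 hv.1
      have : u = v := card_le_one.1 (show (cls f (f v)).card ≤ 1 by omega) u hu v (mem_cls.2 rfl)
      rw [this]; exact hx
    have hPcard : 0 < P.card := by have := H.card_colors_le; omega
    have hPQ : (Q.image part).card + P.card ≤ k := by
      rw [← card_image_of_injOn (s := P) (f := part), ← card_union_of_disjoint, ← H.card_parts]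
      · exact card_le_card (union_subset (image_subset_image (subset_univ _))
          (image_subset_image (subset_univ _)))
      · rw [disjoint_left]
        rintro j hj hj'
        obtain ⟨u, hu, rfl⟩ := mem_image.1 hj
        obtain ⟨v, hv, huv⟩ := mem_image.1 hj'
        simp only [hP, mem_filter, lone, mem_univ, true_and] at hv
        have := hv.1 u huv.symm
        subst this
        simp only [hQ, mem_filter, mem_sdiff] at hu
        exact hv.2 hu.2.1
      · intro u hu v hv huv
        simp only [hP, coe_filter, Set.mem_ofPred_eq, lone, mem_filter, mem_univ, true_and] at hv
        exact hv.1 u huv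
    have hcolQ : ColorableOn part Q (fun v => (L v).filter fun x => x.1 ∉ U) := by
      have hlist : ∀ v ∈ Q, 2 * (k - U.card) ≤ ((L v).filter fun x => x.1 ∉ U).card := by
        intro v _
        have := card_le_card_filter_color_add L v U
        rw [H.card_list] at this
        omega
      -- For empty `U` the parameter does not drop, but `Q` is proper because `P` is nonempty.
      rcases Nat.eq_zero_or_pos U.card with h0 | h0
      · refine H.colorable_of_ne_univ Q _ ?_ (fun v hv => by simpa [h0] using hlist v hv)
        obtain ⟨v, hv⟩ := card_pos.1 hPcard
        intro hQ'
        have : v ∈ Q := by rw [hQ']; exact mem_univ _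
        simp only [hQ, mem_filter, mem_sdiff] at this
        exact (mem_filter.1 hv).2 this.2.1
      · exact H.colorable_of_lt Q _ (k - U.card) (by have := H.pos; omega) (by omega) (by omega) hlist
    obtain ⟨f₁, hf₁⟩ := hcolQ
    obtain ⟨f₂, hf₂, hf₂c⟩ := isColoringOn_of_classes (part := part) (L := L)
      (X := univ.filter fun v => f v ∈ U)
      (f := f) (h := id) (Y := U) (fun u _ v _ => hf.1 u v) (fun v hv => (mem_filter.1 hv).2)
      Function.injective_id.injOn
      (fun c hc => avail_anti L (fun v hv => mem_cls.2 (mem_filter.1 hv).2) (hUacc c hc))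
    obtain ⟨f₃, hf₃, hf₃c⟩ := isColoringOn_of_classes (part := part) (L := L)
      (X := univ.filter fun v => f v ∈ Sᶜ)
      (f := f) (h := h) (Y := Sᶜ) (fun u _ v _ => hf.1 u v) (fun v hv => (mem_filter.1 hv).2) hh
      (fun c hc => avail_anti L (fun v hv => mem_cls.2 (mem_filter.1 hv).2) (mem_sdiff.1 (hht c hc)).1)
    have h12 := (hf₁.mono_list fun v _ => filter_subset _ _).union hf₂ (by
      intro u hu v hv huv
      rw [hf₂c v hv] at huv
      have := (mem_filter.1 (hf₁.1 u hu)).2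
      rw [huv] at this
      exact this (mem_filter.1 hv).2)
    have h123 := h12.union hf₃ (by
      intro u hu v hv huv
      have h3 := (mem_sdiff.1 (hht _ (mem_filter.1 hv).2)).2
      rw [hf₃c v hv] at huv
      rw [← huv] at h3
      refine h3 ?_
      split_ifs with hQu
      · exact hQN u hQu _ (mem_filter.1 (hf₁.1 u hQu)).1
      · have hu' := (mem_union.1 hu).resolve_left hQu
        rw [hf₂c u hu']
        exact hUN (mem_filter.1 hu').2)
    have huniv : Q ∪ (univ.filter fun v => f v ∈ U) ∪ (univ.filter fun v => f v ∈ Sᶜ) = univ := by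
      rw [eq_univ_iff_forall]
      intro v
      simp only [hQ, mem_union, mem_filter, mem_univ, true_and, mem_sdiff, mem_compl]
      tauto
    rw [huniv] at h123
    exact H.not_colorable ⟨_, h123⟩
  -- Every class in `S` loses 2 at `c`, and `|S| ≥ |N| + 1`.
  · intro c hc
    have h1 : ∑ a ∈ S, (∑ v ∈ cls f a, wt L v c + 2) ≤ ∑ a ∈ S, 2 * (cls f a).card :=
      sum_le_sum fun a ha => sum_wt_add_two_le (hNmem c hc a ha)
    have h2 : ∑ a ∈ Sᶜ, ∑ v ∈ cls f a, wt L v c ≤ ∑ a ∈ Sᶜ, 2 * (cls f a).card :=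
      sum_le_sum fun a _ => by
        calc _ ≤ ∑ v ∈ cls f a, 2 := sum_le_sum fun v _ => wt_le_two L v c
          _ = _ := by simp [mul_comm]
    have h3 : ∑ a ∈ S, ∑ v ∈ cls f a, wt L v c + ∑ a ∈ Sᶜ, ∑ v ∈ cls f a, wt L v c =
        ∑ v, wt L v c := by
      rw [sum_add_sum_compl]
      exact sum_fiberwise univ f fun v => wt L v c
    have h4 : ∑ a ∈ S, (cls f a).card + ∑ a ∈ Sᶜ, (cls f a).card = 2 * k + 1 := by
      rw [sum_add_sum_compl, hsumcls]
      simp [H.card_vert]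
    rw [sum_add_distrib, ← mul_sum] at h1
    rw [← mul_sum] at h2
    simp only [sum_const, smul_eq_mul] at h1
    omega
  · intro v hv hvP c hc
    have hvS : f v ∈ S := by
      by_contra hvS
      exact hvP (mem_filter.2 ⟨hv, hvS⟩)
    have := hNmem c hc _ hvS
    rw [hlone v hv, mem_avail_singleton] at this
    omega

end Critical

/-! ### Case inequalities and structural bounds -/

theorem ineq_pair {t y k φ : ℤ} (ht : 0 ≤ t) (hy : 0 ≤ y) (hyk : y ≤ k)
    (hφk : φ < k) (hE : (k - φ) * t ≤ 0) (hD : k + y * (k - y) ≤ φ * (t + 1)) : False := by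
  have ht0 : t = 0 := by
    by_contra h
    have : 0 < (k - φ) * t := mul_pos (by linarith) (by omega)
    linarith
  have := mul_nonneg hy (sub_nonneg.2 hyk)
  subst ht0
  linarith

/-- In the application `s - 1` is the number of lone vertices, `γ = 2k + 1 - m`, `y = |N| - k`, `p =
|P|`, and `φ` counts the frequent colours. Replacing `φ` by its bound `k - s` only weakens `hE` and
`hD`. -/
theorem ineq_lone {s γ y k p φ : ℤ} (hs : 1 ≤ s) (hγ : 1 ≤ γ) (hy : 0 ≤ y) (hp : 0 ≤ p)
    (hpγ : p ≤ γ - 1) (hpx : p ≤ k - γ - y) (hk : k ≤ 2 * s - 1) (hφ : φ ≤ k - s)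
    (hE : (k - φ) * (s - p - γ) ≤ y * p) (hD : k * γ + y * (k + 1 - γ - y) ≤ φ * s) : False := by
  have hE' : s * (s - p - γ) ≤ y * p := by
    rcases le_total (s - p - γ) 0 with h | h
    · have h2 : 0 ≤ y * p := mul_nonneg hy hp
      have h3 : s * (s - p - γ) ≤ 0 := mul_nonpos_of_nonneg_of_nonpos (by linarith) h
      linarith
    · exact (mul_le_mul_of_nonneg_right (by linarith) h).trans hE
  have hD' : k * γ + y * (k + 1 - γ - y) ≤ (k - s) * s :=
    hD.trans (mul_le_mul_of_nonneg_right hφ (by linarith))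
  rcases lt_or_ge y (s - γ) with h | h
  · exact ineq_small s γ y k p hs hγ hy hpγ hE' hD' hk h
  · exact ineq_large s γ y k p hs hγ hy hp hpγ hpx hE' hD' hk h

theorem exists_top_subset {β : Type*} (θ : β → ℕ) (B : Finset β) (d : ℕ) (hd : d ≤ B.card) :
    ∃ A ⊆ B, A.card = d ∧ ∀ a ∈ A, ∀ e ∈ B, e ∉ A → θ e ≤ θ a := by
  induction d with
  | zero => exact ⟨∅, empty_subset _, rfl, by simp⟩
  | succ d ih =>
    obtain ⟨A, hAB, hA, hmax⟩ := ih (by omega)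
    have hne : (B \ A).Nonempty := by
      rw [← card_pos, card_sdiff_of_subset hAB]; omega
    obtain ⟨b, hb, hbmax⟩ := exists_max_image (B \ A) θ hne
    rw [mem_sdiff] at hb
    refine ⟨insert b A, insert_subset hb.1 hAB, by rw [card_insert_of_notMem hb.2, hA], ?_⟩
    intro a ha e he heA
    rw [mem_insert, not_or] at heA
    rcases mem_insert.1 ha with rfl | ha
    · exact hbmax e (mem_sdiff.2 ⟨he, heA.2⟩)
    · exact hmax a ha e he heA.2

namespace Critical

variable {part : V → ι} {L : V → Finset (α × Bool)} {k : ℕ}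

omit [Fintype α] in
theorem sum_card_parts (H : Critical part L k) :
    ∑ j ∈ univ.image part, (cls part j).card = 2 * k + 1 := by
  rw [← H.card_vert, ← card_univ, card_eq_sum_card_image part]
  rfl

omit [Fintype α] in
theorem card_lone_parts (part : V → ι) :
    ((univ.image part).filter fun j => (cls part j).card = 1).card = (lone part).card := by
  rw [← card_image_of_injOn (s := lone part) (f := part)]
  · congr 1
    ext j
    simp only [mem_filter, mem_image, mem_univ, true_and]
    constructor
    · rintro ⟨⟨v, rfl⟩, h⟩
      obtain ⟨w, hw⟩ := card_eq_one.1 h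
      refine ⟨v, mem_lone.2 fun u hu => ?_, rfl⟩
      have h1 : u ∈ cls part (part v) := mem_cls.2 hu
      have h2 : v ∈ cls part (part v) := mem_cls.2 rfl
      rw [hw, mem_singleton] at h1 h2
      rw [h1, h2]
    · rintro ⟨v, hv, rfl⟩
      refine ⟨⟨v, rfl⟩, card_eq_one.2 ⟨v, ?_⟩⟩
      ext u
      rw [mem_cls, mem_singleton]
      exact ⟨mem_lone.1 hv u, fun h => by rw [h]⟩
  · intro u _ v hv h
    exact mem_lone.1 hv u h

omit [Fintype α] in
theorem one_le_card_cls {j : ι} (hj : j ∈ univ.image part) : 1 ≤ (cls part j).card := by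
  obtain ⟨v, -, rfl⟩ := mem_image.1 hj
  exact card_pos.2 ⟨v, mem_cls.2 rfl⟩

/-- Only lone parts can have full weight at `c`; all others lose 2 by `not_mem_avail_part`. -/
theorem sum_wt_le (H : Critical part L k) (c : α) :
    ∑ v, wt L v c + 2 * k ≤ 2 * (2 * k + 1) + 2 * (lone part).card := by
  have h1 : ∑ v, wt L v c = ∑ j ∈ univ.image part, ∑ v ∈ cls part j, wt L v c := by
    rw [← sum_fiberwise_of_maps_to (t := univ.image part) (g := part) (s := univ)
      (fun v hv => mem_image_of_mem part hv)]
    rfl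
  have h2 : ∑ j ∈ univ.image part, (∑ v ∈ cls part j, wt L v c + 2) ≤
      ∑ j ∈ univ.image part, (2 * (cls part j).card + if (cls part j).card = 1 then 2 else 0) := by
    refine sum_le_sum fun j hj => ?_
    split_ifs with h
    · have : ∑ v ∈ cls part j, wt L v c ≤ ∑ v ∈ cls part j, 2 :=
        sum_le_sum fun v _ => wt_le_two L v c
      simp only [sum_const, smul_eq_mul] at this
      omega
    · have := one_le_card_cls hj
      exact sum_wt_add_two_le (H.not_mem_avail_part j (by omega) c)
  rw [sum_add_distrib, sum_add_distrib, ← mul_sum, H.sum_card_parts, ← h1, ← sum_filter, sum_const,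
    sum_const, H.card_parts, card_lone_parts] at h2
  simp only [smul_eq_mul] at h2
  omega

/-- The two lists on such a part are disjoint, so `4k ≤ 2m`. -/
theorem card_colors_of_pair (H : Critical part L k) {j : ι} (hj : (cls part j).card = 2) :
    Fintype.card α = 2 * k := by
  obtain ⟨u, v, huv, hP⟩ := card_eq_two.1 hj
  have hdis : Disjoint (L u) (L v) := by
    rw [disjoint_left]
    rintro ⟨c, s⟩ hu hv
    refine H.not_mem_avail_part j hj.ge c (mem_avail.2 ⟨s, fun w hw => ?_⟩)
    rw [hP, mem_insert, mem_singleton] at hw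
    rcases hw with rfl | rfl <;> assumption
  have h1 := card_le_univ (L u ∪ L v)
  rw [card_union_of_disjoint hdis, H.card_list, H.card_list, Fintype.card_prod, Fintype.card_bool]
    at h1
  have := H.card_colors_le
  omega

-- All parts but the lone ones have at least three vertices, so `3k ≤ 2k + 1 + 2t` for `t` lone
-- vertices.
omit [Fintype α] in
theorem le_two_mul_card_lone (H : Critical part L k) (h2 : ∀ j, (cls part j).card ≠ 2) :
    k ≤ 2 * (lone part).card + 1 := by
  have h : ∑ j ∈ univ.image part, 3 ≤
      ∑ j ∈ univ.image part, ((cls part j).card + if (cls part j).card = 1 then 2 else 0) := by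
    refine sum_le_sum fun j hj => ?_
    have := one_le_card_cls hj
    have := h2 j
    split_ifs <;> omega
  rw [sum_add_distrib, H.sum_card_parts, ← sum_filter, sum_const, sum_const, H.card_parts,
    card_lone_parts] at h
  simp only [smul_eq_mul] at h
  omega

theorem le_card_colors (H : Critical part L k) : k ≤ Fintype.card α := by
  obtain ⟨v⟩ := H.nonempty_vert
  exact (H.le_card_avail_singleton v).trans (card_le_univ _)

end Critical

/-! ### Maximal partial colourings and exchange -/

omit [Fintype α] [Fintype V] in
theorem IsColoringOn.replace {part : V → ι} {X Y : Finset V} {L : V → Finset (α × Bool)}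
    {g : V → α × Bool} (hg : IsColoringOn part X L g) {j : ι} {c : α} {s : Bool}
    (hY : ∀ v ∈ Y, part v = j ∧ (c, s) ∈ L v) :
    ColorableOn part ((X.filter fun v => (g v).1 ≠ c) ∪ Y) L := by
  have h1 : IsColoringOn part (X.filter fun v => (g v).1 ≠ c) L g :=
    ⟨fun v hv => hg.1 v (mem_filter.1 hv).1,
      fun u hu v hv => hg.2 u (mem_filter.1 hu).1 v (mem_filter.1 hv).1⟩
  have h2 : IsColoringOn part Y L (fun _ => (c, s)) :=
    ⟨fun v hv => (hY v hv).2, fun u hu v hv _ => ⟨(hY u hu).1.trans (hY v hv).1.symm, rfl⟩⟩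
  exact ⟨_, h1.union h2 fun u hu v _ => (mem_filter.1 hu).2⟩

theorem not_mem_lone_of_two_le {part : V → ι} {v : V} (h : 2 ≤ (cls part (part v)).card) :
    v ∉ lone part := by
  intro hv
  have : cls part (part v) ⊆ {v} := fun u hu => mem_singleton.2 (mem_lone.1 hv u (mem_cls.1 hu))
  have := card_le_card this
  rw [card_singleton] at this
  omega

/-- `g` is a colouring of a largest possible set `X` of vertices that are not alone in their parts,
by colours outside `F`. -/
structure MaxPartial (part : V → ι) (L : V → Finset (α × Bool)) (F : Finset α) (X : Finset V)
    (g : V → α × Bool) : Prop where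
  isColoring : IsColoringOn part X (fun v => (L v).filter fun x => x.1 ∉ F) g
  disjoint : Disjoint X (lone part)
  card_le : ∀ X', Disjoint X' (lone part) →
    ColorableOn part X' (fun v => (L v).filter fun x => x.1 ∉ F) → X'.card ≤ X.card
  card_big_le : ∀ X', Disjoint X' (lone part) →
    ColorableOn part X' (fun v => (L v).filter fun x => x.1 ∉ F) → X'.card = X.card →
    (X'ᶜ.filter fun v => 3 ≤ (cls part (part v)).card).card ≤
      (Xᶜ.filter fun v => 3 ≤ (cls part (part v)).card).card

omit [Fintype α] in
theorem exists_maxPartial [Nonempty α] (part : V → ι) (L : V → Finset (α × Bool)) (F : Finset α) :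
    ∃ X g, MaxPartial part L F X g := by
  set L' : V → Finset (α × Bool) := fun v => (L v).filter fun x => x.1 ∉ F
  obtain ⟨X₀, hX₀, hmax⟩ := exists_max_image
    (univ.filter fun X : Finset V => Disjoint X (lone part) ∧ ColorableOn part X L') card
    ⟨∅, mem_filter.2 ⟨mem_univ _, disjoint_empty_left _, fun _ => (Classical.arbitrary α, true),
      by simp [IsColoringOn]⟩⟩
  obtain ⟨X, hX, hmax2⟩ := exists_max_image
    (univ.filter fun X : Finset V => (Disjoint X (lone part) ∧ ColorableOn part X L') ∧
      X.card = X₀.card)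
    (fun X => (Xᶜ.filter fun v => 3 ≤ (cls part (part v)).card).card)
    ⟨X₀, mem_filter.2 ⟨mem_univ _, (mem_filter.1 hX₀).2, rfl⟩⟩
  simp only [mem_filter, mem_univ, true_and] at hX₀ hmax hX hmax2
  obtain ⟨⟨hdis, g, hg⟩, hcard⟩ := hX
  exact ⟨X, g, hg, hdis, fun X' h1 h2 => hcard ▸ hmax X' ⟨h1, h2⟩,
    fun X' h1 h2 h3 => hmax2 X' ⟨⟨h1, h2⟩, h3.trans hcard⟩⟩

namespace MaxPartial

variable {part : V → ι} {L : V → Finset (α × Bool)} {F : Finset α} {X : Finset V}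
  {g : V → α × Bool}

omit [Fintype α] in
theorem disjoint_of_part {j : ι} (hj : 2 ≤ (cls part j).card) {Y : Finset V}
    (hY : ∀ v ∈ Y, part v = j) : Disjoint Y (lone part) := by
  rw [disjoint_left]
  intro v hv
  exact not_mem_lone_of_two_le (by rw [hY v hv]; exact hj)

-- Otherwise taking `c` away from its class and giving it to these vertices would enlarge `X`.
omit [Fintype α] in
theorem card_filter_le (hM : MaxPartial part L F X g) {j : ι} (hj : 2 ≤ (cls part j).card)
    {c : α} (hc : c ∉ F) (s : Bool) :
    ((Xᶜ.filter fun v => part v = j).filter fun v => (c, s) ∈ L v).card ≤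
      (X.filter fun v => (g v).1 = c).card := by
  set Y := (Xᶜ.filter fun v => part v = j).filter fun v => (c, s) ∈ L v with hY
  have hYj : ∀ v ∈ Y, part v = j := fun v hv => (mem_filter.1 (mem_filter.1 hv).1).2
  have h1 := hM.card_le _ (disjoint_union_left.2
    ⟨hM.disjoint.mono_left (filter_subset _ _), disjoint_of_part hj hYj⟩)
    (hM.isColoring.replace (Y := Y) (j := j) (c := c) (s := s) fun v hv =>
      ⟨hYj v hv, mem_filter.2 ⟨(mem_filter.1 hv).2, hc⟩⟩)
  rw [card_union_of_disjoint] at h1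
  · have := card_filter_add_card_filter_not (s := X) (fun v => (g v).1 = c)
    simp only [ne_eq] at h1
    omega
  · rw [disjoint_left]
    intro v hv hv'
    exact mem_compl.1 (mem_filter.1 (mem_filter.1 hv').1).1 (mem_filter.1 hv).1

omit [Fintype α] in
theorem filter_eq_empty_of_mem (hM : MaxPartial part L F X g) {v : V} (hv : v ∈ X)
    (hj : 2 ≤ (cls part (part v)).card) :
    ((Xᶜ.filter fun u => part u = part v).filter fun u => g v ∈ L u) = ∅ := by
  set Y := (Xᶜ.filter fun u => part u = part v).filter fun u => g v ∈ L u with hY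
  have hYj : ∀ u ∈ Y, part u = part v := fun v hv => (mem_filter.1 (mem_filter.1 hv).1).2
  have hgF : (g v).1 ∉ F := (mem_filter.1 (hM.isColoring.1 v hv)).2
  have h1 := hM.card_le _ (disjoint_union_left.2
    ⟨hM.disjoint.mono_left (filter_subset _ _), disjoint_union_left.2
      ⟨hM.disjoint.mono_left (filter_subset _ _), disjoint_of_part hj hYj⟩⟩)
    (hM.isColoring.replace (Y := (X.filter fun u => (g u).1 = (g v).1) ∪ Y) (j := part v)
      (c := (g v).1) (s := (g v).2) fun u hu => by
        rcases mem_union.1 hu with hu | hu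
        · have h := hM.isColoring.2 u (mem_filter.1 hu).1 v hv (mem_filter.1 hu).2
          refine ⟨h.1, ?_⟩
          rw [← h.2, ← (mem_filter.1 hu).2]
          exact hM.isColoring.1 u (mem_filter.1 hu).1
        · exact ⟨hYj u hu, mem_filter.2 ⟨(mem_filter.1 hu).2, hgF⟩⟩)
  have hdis : Disjoint X Y := by
    rw [disjoint_left]
    intro u hu hu'
    exact mem_compl.1 (mem_filter.1 (mem_filter.1 hu').1).1 hu
  have h2 : (X.filter fun u => (g u).1 ≠ (g v).1) ∪ ((X.filter fun u => (g u).1 = (g v).1) ∪ Y) =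
      X ∪ Y := by
    rw [← union_assoc, union_comm (X.filter _), filter_union_filter_not_eq]
  rw [h2, card_union_of_disjoint hdis] at h1
  exact card_eq_zero.1 (by omega)

omit [Fintype α] in
theorem sum_wt_le (hM : MaxPartial part L F X g) {j : ι} (hj : 2 ≤ (cls part j).card)
    {c : α} (hc : c ∉ F) :
    ∑ v ∈ Xᶜ.filter (fun v => part v = j), wt L v c ≤ 2 * (X.filter fun v => (g v).1 = c).card := by
  rw [sum_wt_vertices]
  have h1 := hM.card_filter_le hj hc true
  have h2 := hM.card_filter_le hj hc false
  omega

-- An uncoloured vertex of the part that saw the pair `g v` could join the class of `v`, so only the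
-- opposite sign contributes.
omit [Fintype α] in
theorem sum_wt_lt (hM : MaxPartial part L F X g) {v : V} (hv : v ∈ X)
    (hj : 2 ≤ (cls part (part v)).card) :
    ∑ u ∈ Xᶜ.filter (fun u => part u = part v), wt L u (g v).1 <
      2 * (X.filter fun u => (g u).1 = (g v).1).card := by
  have hgF : (g v).1 ∉ F := (mem_filter.1 (hM.isColoring.1 v hv)).2
  have h0 := hM.filter_eq_empty_of_mem hv hj
  have hpos : 0 < (X.filter fun u => (g u).1 = (g v).1).card :=
    card_pos.2 ⟨v, mem_filter.2 ⟨hv, rfl⟩⟩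
  rw [sum_wt_vertices]
  have h1 := hM.card_filter_le hj hgF true
  have h2 := hM.card_filter_le hj hgF false
  rcases hs : (g v).2 with _ | _
  · rw [show g v = ((g v).1, false) from Prod.ext rfl hs] at h0
    rw [h0, card_empty]; omega
  · rw [show g v = ((g v).1, true) from Prod.ext rfl hs] at h0
    rw [h0, card_empty]; omega

theorem sum_card_classes (hM : MaxPartial part L F X g) :
    ∑ c ∈ Fᶜ, (X.filter fun v => (g v).1 = c).card = X.card := by
  refine (card_eq_sum_card_fiberwise (f := fun v => (g v).1) fun v hv => ?_).symm
  exact mem_coe.2 (mem_compl.2 (mem_filter.1 (hM.isColoring.1 v hv)).2)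

theorem sum_sum_wt_le (hM : MaxPartial part L F X g) {j : ι} (hj : 2 ≤ (cls part j).card) :
    ∑ c ∈ Fᶜ, ∑ v ∈ Xᶜ.filter (fun v => part v = j), wt L v c ≤ 2 * X.card := by
  rw [← hM.sum_card_classes, mul_sum]
  exact sum_le_sum fun c hc => hM.sum_wt_le hj (mem_compl.1 hc)

end MaxPartial

-- The lists on `Z` have total weight `2k|Z|`, which is also the most that `k` colours can carry.
-- Each colour of `F` unavailable on `Z` loses 2, to be made up outside `F`.
omit [Fintype V] in
theorem two_mul_le_card_inter_avail {L : V → Finset (α × Bool)} {k : ℕ} {F : Finset α}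
    (hF : F.card = k) (hL : ∀ v, (L v).card = 2 * k) (Z : Finset V) :
    2 * k ≤ 2 * (F ∩ avail L Z).card + ∑ c ∈ Fᶜ, ∑ v ∈ Z, wt L v c := by
  have h1 : ∑ c ∈ F, (∑ v ∈ Z, wt L v c + if c ∈ avail L Z then 0 else 2) ≤ ∑ c ∈ F, 2 * Z.card := by
    refine sum_le_sum fun c _ => ?_
    split_ifs with h
    · calc _ ≤ ∑ v ∈ Z, 2 := by
            rw [add_zero]; exact sum_le_sum fun v _ => wt_le_two L v c
        _ = _ := by simp [mul_comm]
    · exact sum_wt_add_two_le h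
  have h2 : ∑ c, ∑ v ∈ Z, wt L v c = Z.card * (2 * k) := by
    rw [sum_comm]
    simp only [sum_wt_univ, hL, sum_const, smul_eq_mul]
  rw [← sum_add_sum_compl F] at h2
  have h3 : ∑ c ∈ F, (if c ∈ avail L Z then 0 else 2) = 2 * (F \ avail L Z).card := by
    simp only [← ite_not (p := _ ∈ avail L Z)]
    rw [← sum_filter, sum_const, smul_eq_mul, mul_comm, filter_notMem_eq_sdiff]
  rw [sum_add_distrib, h3, sum_const, hF, smul_eq_mul] at h1
  have h4 := card_inter_add_card_sdiff F (avail L Z)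
  have h5 : k * (2 * Z.card) = Z.card * (2 * k) := by ring
  omega

/-- Colour classes outside `F` and merged classes inside `F` are completed by single vertices. -/
theorem exists_nearAcceptable_of_merge {part : V → ι} {L : V → Finset (α × Bool)}
    {F A : Finset α} {X Y : Finset V} {g : V → α × Bool} {own : α → V} {h : V → α}
    (hg : IsColoringOn part X (fun v => (L v).filter fun x => x.1 ∉ F) g)
    (hX : Disjoint X (lone part)) (hA : A ⊆ F) (hinj : Set.InjOn own A)
    (hown : ∀ a ∈ A, own a ∈ lone part ∧ 0 < wt L (own a) a)
    (hYX : Disjoint Y X) (hY : Disjoint Y (lone part)) (hF : ∀ v ∈ Y, h v ∈ F)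
    (hpart : ∀ u ∈ Y, ∀ v ∈ Y, h u = h v → part u = part v)
    (hav : ∀ v ∈ Y, h v ∈ avail L (Y.filter fun u => h u = h v))
    (hcard : Xᶜ.card + (Y.image h).card ≤ F.card + Y.card) :
    ∃ f, NearAcceptable part L (F \ A) f := by
  rcases isEmpty_or_nonempty α with hα | hα
  · exact ⟨h, fun u => (hα.false (h u)).elim, fun c => (hα.false c).elim⟩
  -- Merged classes take precedence: a colour of `A` used on `Y` gives up its own vertex.
  set A' := A \ Y.image h with hA'
  have hYim : Y.image h ⊆ F := fun c hc => by
    obtain ⟨v, hv, rfl⟩ := mem_image.1 hc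
    exact hF v hv
  have hA'A : A' ⊆ A := sdiff_subset
  have hoX : ∀ a ∈ A', own a ∉ X := fun a ha hx =>
    disjoint_left.1 hX hx (hown a (hA'A ha)).1
  have hoY : ∀ a ∈ A', own a ∉ Y := fun a ha hx =>
    disjoint_left.1 hY hx (hown a (hA'A ha)).1
  set R := (Xᶜ \ Y) \ A'.image own with hR
  set F' := (F \ Y.image h) \ A' with hF'
  have hRF : R.card ≤ F'.card := by
    have e1 : (Xᶜ \ Y).card = Xᶜ.card - Y.card := card_sdiff_of_subset fun v hv =>
      mem_compl.2 (disjoint_left.1 hYX hv)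
    have e2 : R.card = (Xᶜ \ Y).card - A'.card := by
      rw [hR, card_sdiff_of_subset, card_image_of_injOn (hinj.mono (by exact_mod_cast hA'A))]
      intro v hv
      obtain ⟨a, ha, rfl⟩ := mem_image.1 hv
      exact mem_sdiff.2 ⟨mem_compl.2 (hoX a ha), hoY a ha⟩
    have e3 : F'.card = (F \ Y.image h).card - A'.card :=
      card_sdiff_of_subset (sdiff_subset_sdiff hA subset_rfl)
    have e4 : (F \ Y.image h).card = F.card - (Y.image h).card := card_sdiff_of_subset hYim
    omega
  obtain ⟨q, hq, hqF⟩ := exists_injOn_of_hall R (fun _ => F') (by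
    intro E hE
    rcases E.eq_empty_or_nonempty with rfl | ⟨v, hv⟩
    · simp
    · exact (card_le_card hE).trans (hRF.trans
        (card_le_card (subset_biUnion_of_mem (fun _ => F') hv))))
  have hinv : ∀ v, ∃ a, v ∈ A'.image own → a ∈ A' ∧ own a = v := by
    intro v
    by_cases hv : v ∈ A'.image own
    · obtain ⟨a, ha, hav⟩ := mem_image.1 hv
      exact ⟨a, fun _ => ⟨ha, hav⟩⟩
    · exact ⟨Classical.arbitrary α, fun h => absurd h hv⟩
  choose p hp using hinv
  let f : V → α := fun v =>
    if v ∈ X then (g v).1 else if v ∈ Y then h v else if v ∈ A'.image own then p v else q v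
  have fX : ∀ v ∈ X, f v = (g v).1 := fun v hv => if_pos hv
  have fY : ∀ v ∈ Y, f v = h v := fun v hv => by
    simp only [f, if_neg (disjoint_left.1 hYX hv), if_pos hv]
  have fA : ∀ v ∈ A'.image own, v ∉ X ∧ v ∉ Y ∧ f v = p v := fun v hv => by
    obtain ⟨a, ha, rfl⟩ := mem_image.1 hv
    exact ⟨hoX a ha, hoY a ha, by simp only [f, if_neg (hoX a ha), if_neg (hoY a ha), if_pos hv]⟩
  have fR : ∀ v, v ∉ X → v ∉ Y → v ∉ A'.image own → v ∈ R ∧ f v = q v := fun v h1 h2 h3 =>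
    ⟨mem_sdiff.2 ⟨mem_sdiff.2 ⟨mem_compl.2 h1, h2⟩, h3⟩, by simp only [f, if_neg h1, if_neg h2, if_neg h3]⟩
  -- each colour lies in exactly one of the four blocks
  have hcases : ∀ c, (c ∉ F ∧ ∀ v, f v = c → v ∈ X) ∨ (c ∈ Y.image h ∧ ∀ v, f v = c → v ∈ Y) ∨
      (c ∈ A' ∧ ∀ v, f v = c → v = own c) ∨
      (c ∈ F' ∧ ∀ v, f v = c → v ∈ R ∧ f v = q v) := by
    intro c
    have hvc : ∀ v, f v = c → (v ∈ X ∧ c ∉ F) ∨ (v ∈ Y ∧ c ∈ Y.image h) ∨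
        (v = own c ∧ c ∈ A') ∨ ((v ∈ R ∧ f v = q v) ∧ c ∈ F') := by
      intro v hv
      by_cases h1 : v ∈ X
      · left
        rw [fX v h1] at hv
        exact ⟨h1, hv ▸ (mem_filter.1 (hg.1 v h1)).2⟩
      by_cases h2 : v ∈ Y
      · right; left
        rw [fY v h2] at hv
        exact ⟨h2, hv ▸ mem_image_of_mem h h2⟩
      by_cases h3 : v ∈ A'.image own
      · right; right; left
        rw [(fA v h3).2.2] at hv
        rw [← hv]
        exact ⟨(hp v h3).2.symm, (hp v h3).1⟩
      · right; right; right
        have h4 := fR v h1 h2 h3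
        refine ⟨h4, ?_⟩
        rw [← hv, h4.2]
        exact hqF v h4.1
    have hcA : c ∈ A' → c ∈ F ∧ c ∉ Y.image h := fun hc =>
      ⟨hA (mem_sdiff.1 hc).1, (mem_sdiff.1 hc).2⟩
    have hcF' : c ∈ F' ↔ (c ∈ F ∧ c ∉ Y.image h) ∧ c ∉ A' := by
      rw [hF', mem_sdiff, mem_sdiff]
    have hcY : c ∈ Y.image h → c ∈ F := fun hc => hYim hc
    by_cases k1 : c ∈ F
    · by_cases k2 : c ∈ Y.image h
      · exact Or.inr (Or.inl ⟨k2, fun v hv => by have := hvc v hv; tauto⟩)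
      · by_cases k3 : c ∈ A'
        · exact Or.inr (Or.inr (Or.inl ⟨k3, fun v hv => by have := hvc v hv; tauto⟩))
        · exact Or.inr (Or.inr (Or.inr ⟨by tauto, fun v hv => by have := hvc v hv; tauto⟩))
    · exact Or.inl ⟨k1, fun v hv => by have := hvc v hv; tauto⟩
  refine ⟨f, fun u v huv => ?_, fun c => ?_⟩
  · rcases hcases (f v) with ⟨-, hc⟩ | ⟨-, hc⟩ | ⟨-, hc⟩ | ⟨-, hc⟩
    · have hu := hc u huv
      have hv := hc v rfl
      rw [fX u hu, fX v hv] at huv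
      exact (hg.2 u hu v hv huv).1
    · have hu := hc u huv
      have hv := hc v rfl
      rw [fY u hu, fY v hv] at huv
      exact hpart u hu v hv huv
    · exact congrArg part ((hc u huv).trans (hc v rfl).symm)
    · have hu := hc u huv
      have hv := hc v rfl
      rw [hu.2, hv.2] at huv
      rw [hq hu.1 hv.1 huv]
  · rcases hcases c with ⟨-, hc⟩ | ⟨hcY, hc⟩ | ⟨hcA, hc⟩ | ⟨hcF, hc⟩
    · left
      rcases (cls f c).eq_empty_or_nonempty with he | ⟨v, hv⟩
      · rw [he]; exact mem_avail.2 ⟨true, by simp⟩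
      · rw [mem_cls] at hv
        have hvX := hc v hv
        refine mem_avail.2 ⟨(g v).2, fun u hu => ?_⟩
        rw [mem_cls] at hu
        have huX := hc u hu
        rw [fX u huX] at hu
        rw [fX v hvX] at hv
        rw [← (hg.2 u huX v hvX (hu.trans hv.symm)).2, ← hu]
        exact (mem_filter.1 (hg.1 u huX)).1
    · left
      obtain ⟨v, hv, rfl⟩ := mem_image.1 hcY
      refine avail_anti L (fun u hu => ?_) (hav v hv)
      rw [mem_cls] at hu
      have huY := hc u hu
      rw [fY u huY] at hu
      exact mem_filter.2 ⟨huY, hu⟩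
    · left
      refine avail_anti L (Z' := {own c}) (fun u hu => mem_singleton.2 (hc u (mem_cls.1 hu))) ?_
      rw [mem_avail_singleton]
      exact (hown c (hA'A hcA)).2
    · right
      refine ⟨card_le_one.2 fun u hu v hv => ?_, ?_⟩
      · rw [mem_cls] at hu hv
        have hu' := hc u hu
        have hv' := hc v hv
        rw [hu'.2] at hu
        rw [hv'.2] at hv
        exact hq hu'.1 hv'.1 (hu.trans hv.symm)
      · rw [hF', mem_sdiff, mem_sdiff] at hcF
        refine mem_sdiff.2 ⟨hcF.1.1, fun hcA => hcF.2 (mem_sdiff.2 ⟨hcA, hcF.1.2⟩)⟩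


/-! ### Existence of near acceptable maps -/

namespace Critical

variable {part : V → ι} {L : V → Finset (α × Bool)} {k : ℕ}

/-- Merging the uncoloured vertices of a part of `J` into one class saves all but one of them;
`hcard` says that the savings leave at most `k = |F|` classes. -/
theorem exists_nearAcceptable_of_parts {F A : Finset α} {X : Finset V}
    {g : V → α × Bool} (hM : MaxPartial part L F X g) (hF : F.card = k)
    (hA : A ⊆ F) {own : α → V} (hinj : Set.InjOn own A)
    (hown : ∀ a ∈ A, own a ∈ lone part ∧ 0 < wt L (own a) a) [Nonempty α] {J : Finset ι}
    (hJ : ∀ j ∈ J, 2 ≤ (Xᶜ.filter fun v => part v = j).card)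
    (hHall : ∀ E ⊆ J, E.card ≤
      (E.biUnion fun j => F ∩ avail L (Xᶜ.filter fun v => part v = j)).card)
    (hcard : Xᶜ.card + J.card ≤ k + ∑ j ∈ J, (Xᶜ.filter fun v => part v = j).card) :
    ∃ f, NearAcceptable part L (F \ A) f := by
  obtain ⟨r, hr, hrT⟩ := exists_injOn_of_hall J _ hHall
  have hYsum : (Xᶜ.filter fun v => part v ∈ J).card =
      ∑ j ∈ J, (Xᶜ.filter fun v => part v = j).card := by
    rw [card_eq_sum_card_fiberwise (f := part) (t := J) (fun v hv => mem_coe.2 (mem_filter.1 (mem_coe.1 hv)).2)]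
    refine sum_congr rfl fun j hj => ?_
    rw [filter_filter]
    congr 1
    ext v
    simp only [mem_filter, and_congr_right_iff]
    intro _
    exact ⟨fun h => h.2, fun h => ⟨h ▸ hj, h⟩⟩
  have hrJ : ∀ u ∈ Xᶜ.filter (fun v => part v ∈ J), ∀ v ∈ Xᶜ.filter (fun v => part v ∈ J),
      r (part u) = r (part v) → part u = part v := fun u hu v hv h =>
    hr (mem_filter.1 hu).2 (mem_filter.1 hv).2 h
  refine exists_nearAcceptable_of_merge (Y := Xᶜ.filter fun v => part v ∈ J)
    (h := fun v => r (part v)) hM.isColoring hM.disjoint hA hinj hown ?_ ?_ ?_ hrJ ?_ ?_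
  · exact disjoint_left.2 fun v hv => mem_compl.1 (mem_filter.1 hv).1
  · refine disjoint_left.2 fun v hv => not_mem_lone_of_two_le ?_
    refine (hJ _ (mem_filter.1 hv).2).trans (card_le_card fun u hu => mem_cls.2 (mem_filter.1 hu).2)
  · exact fun v hv => (mem_inter.1 (hrT _ (mem_filter.1 hv).2)).1
  · intro v hv
    refine avail_anti L (fun u hu => ?_) (mem_inter.1 (hrT _ (mem_filter.1 hv).2)).2
    have hu := mem_filter.1 hu
    exact mem_filter.2 ⟨(mem_filter.1 hu.1).1, hrJ u hu.1 v hv hu.2⟩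
  · have : ((Xᶜ.filter fun v => part v ∈ J).image fun v => r (part v)).card ≤ J.card := by
      refine (card_le_card (t := J.image r) fun c hc => ?_).trans card_image_le
      obtain ⟨v, hv, rfl⟩ := mem_image.1 hc
      exact mem_image_of_mem r (mem_filter.1 hv).2
    omega

/-- Near acceptable maps exist for every set `F` of `k` colours, some of which may be given their
own vertices. -/
theorem exists_nearAcceptable (H : Critical part L k) {F A : Finset α} (hF : F.card = k)
    (hA : A ⊆ F) {own : α → V} (hinj : Set.InjOn own A)
    (hown : ∀ a ∈ A, own a ∈ lone part ∧ 0 < wt L (own a) a) :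
    ∃ f, NearAcceptable part L (F \ A) f := by
  have := H.nonempty_colors
  have hkpos := H.pos
  obtain ⟨X, g, hM⟩ := exists_maxPartial part L F
  set W : ι → Finset V := fun j => Xᶜ.filter fun v => part v = j with hW
  have hWP : ∀ j, W j ⊆ cls part j := fun j v hv => mem_cls.2 (mem_filter.1 hv).2
  have hXW : X.card + Xᶜ.card = 2 * k + 1 := by rw [card_add_card_compl, H.card_vert]
  -- few uncoloured vertices
  rcases le_or_gt Xᶜ.card k with hle | hgt
  · exact exists_nearAcceptable_of_parts hM hF hA hinj hown (J := ∅) (by simp) (by simp)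
      (by simpa using hle)
  set M := (univ.image part).filter fun j => 2 ≤ (W j).card with hMdef
  have hM2 : ∀ j ∈ M, 2 ≤ (W j).card := fun j hj => (mem_filter.1 hj).2
  have hMP : ∀ j ∈ M, 2 ≤ (cls part j).card := fun j hj =>
    (hM2 j hj).trans (card_le_card (hWP j))
  -- Merging in all parts of `M` leaves at most one class per part.
  have hWsum : Xᶜ.card + M.card ≤ k + ∑ j ∈ M, (W j).card := by
    have h1 : Xᶜ.card = ∑ j ∈ univ.image part, (W j).card :=
      card_eq_sum_card_fiberwise fun v _ => by simp
    have h2 : ∑ j ∈ univ.image part, (W j).card + ∑ j ∈ univ.image part, (if 2 ≤ (W j).card then 1 else 0) ≤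
        ∑ j ∈ univ.image part, (1 + if 2 ≤ (W j).card then (W j).card else 0) := by
      rw [← sum_add_distrib]
      refine sum_le_sum fun j _ => ?_
      split_ifs <;> omega
    rw [sum_add_distrib, ← sum_filter, ← sum_filter, ← card_eq_sum_ones, ← card_eq_sum_ones,
      H.card_parts, ← h1] at h2
    exact h2
  have hT : ∀ j ∈ M, k ≤ (F ∩ avail L (W j)).card + X.card := by
    intro j hj
    have h1 := two_mul_le_card_inter_avail hF H.card_list (W j)
    have h2 := hM.sum_sum_wt_le (hMP j hj)
    change ∑ c ∈ Fᶜ, ∑ v ∈ W j, wt L v c ≤ _ at h2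
    omega
  have hHall : ∀ J ⊆ M, J.card + X.card ≤ k → ∀ E ⊆ J, E.card ≤
      (E.biUnion fun j => F ∩ avail L (W j)).card := by
    intro J hJ hJk E hE
    rcases E.eq_empty_or_nonempty with rfl | ⟨j, hj⟩
    · simp
    · have h1 := hT j (hJ (hE hj))
      have h2 := card_le_card hE
      have h3 := card_le_card (subset_biUnion_of_mem (fun j => F ∩ avail L (W j)) hj)
      omega
  rcases le_or_gt (M.card + X.card) k with hMk | hMk
  · exact exists_nearAcceptable_of_parts hM hF hA hinj hown hM2 (hHall M subset_rfl hMk) hWsum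
  -- By `hT`, any `k - |X|` parts of `M` can be merged, each saving at least 1. But `|Xᶜ| - k = k +
  -- 1 - |X|`, so one further saving is needed.
  have hJsum : ∀ J ⊆ M, 2 * J.card ≤ ∑ j ∈ J, (W j).card := by
    intro J hJ
    rw [mul_comm, ← smul_eq_mul]
    exact card_nsmul_le_sum _ _ _ fun j hj => hM2 j (hJ hj)
  by_cases hbig : ∃ j₀ ∈ M, 3 ≤ (W j₀).card
  · obtain ⟨j₀, hj₀, hj₀3⟩ := hbig
    rcases lt_or_ge X.card k with hlt | hge
    · obtain ⟨J', hJ', hJ'c⟩ := exists_subset_card_eq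
        (show k - X.card - 1 ≤ (M.erase j₀).card by rw [card_erase_of_mem hj₀]; omega)
      have hj₀J' : j₀ ∉ J' := fun h => notMem_erase j₀ M (hJ' h)
      have hJM : insert j₀ J' ⊆ M := insert_subset hj₀ (hJ'.trans (erase_subset _ _))
      have hJc : (insert j₀ J').card = k - X.card := by
        rw [card_insert_of_notMem hj₀J', hJ'c]; omega
      have h1 := hJsum J' (hJ'.trans (erase_subset _ _))
      refine exists_nearAcceptable_of_parts hM hF hA hinj hown (J := insert j₀ J')
        (fun j hj => hM2 j (hJM hj)) (hHall _ hJM (by omega)) ?_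
      rw [sum_insert hj₀J', hJc]
      change _ ≤ k + ((W j₀).card + ∑ j ∈ J', (W j).card)
      omega
    -- Now merging a single pair is enough, and the weights leave some signed colour of `F` common
    -- to two lists.
    · have hpair : ∃ c ∈ F, ∃ s, 2 ≤ ((W j₀).filter fun v => (c, s) ∈ L v).card := by
        by_contra! hno
        have h1 : ∑ c ∈ F, ∑ v ∈ W j₀, wt L v c ≤ F.card * 2 :=
          sum_le_card_nsmul _ _ _ fun c hc => by
            rw [sum_wt_vertices]
            have := hno c hc true
            have := hno c hc false
            omega
        have h2 := hM.sum_sum_wt_le (hMP j₀ hj₀)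
        have h3 : ∑ c, ∑ v ∈ W j₀, wt L v c = (W j₀).card * (2 * k) := by
          rw [sum_comm]
          simp only [sum_wt_univ, H.card_list, sum_const, smul_eq_mul]
        rw [← sum_add_sum_compl F] at h3
        have h4 : 3 * (2 * k) ≤ (W j₀).card * (2 * k) := Nat.mul_le_mul_right _ hj₀3
        change ∑ c ∈ Fᶜ, ∑ v ∈ W j₀, wt L v c ≤ _ at h2
        omega
      obtain ⟨c, hc, s, hcs⟩ := hpair
      obtain ⟨Y, hY, hYc⟩ := exists_subset_card_eq hcs
      have hYj : ∀ v ∈ Y, part v = j₀ := fun v hv =>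
        (mem_filter.1 (mem_filter.1 (hY hv)).1).2
      refine exists_nearAcceptable_of_merge (Y := Y) (h := fun _ => c) hM.isColoring hM.disjoint hA
        hinj hown ?_ (MaxPartial.disjoint_of_part (hMP j₀ hj₀) hYj) (fun _ _ => hc)
        (fun u hu v hv _ => (hYj u hu).trans (hYj v hv).symm) ?_ ?_
      · exact disjoint_left.2 fun v hv =>
          mem_compl.1 (mem_filter.1 (mem_filter.1 (hY hv)).1).1
      · exact fun v _ => mem_avail.2 ⟨s, fun u hu => (mem_filter.1 (hY (mem_filter.1 hu).1)).2⟩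
      · have : (Y.image fun _ => c).card ≤ 1 :=
          (card_le_card (t := {c}) fun x hx => by
            obtain ⟨_, _, rfl⟩ := mem_image.1 hx
            exact mem_singleton_self _).trans (card_singleton c).le
        omega
  push Not at hbig
  -- A part with one more available colour than guaranteed can be matched last, so one extra part
  -- can be merged.
  by_cases hslack : ∃ j₀ ∈ M, k < (F ∩ avail L (W j₀)).card + X.card
  · obtain ⟨j₀, hj₀, hj₀T⟩ := hslack
    obtain ⟨J', hJ', hJ'c⟩ := exists_subset_card_eq
      (show k - X.card ≤ (M.erase j₀).card by rw [card_erase_of_mem hj₀]; omega)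
    have hj₀J' : j₀ ∉ J' := fun h => notMem_erase j₀ M (hJ' h)
    have hJ'M : J' ⊆ M := hJ'.trans (erase_subset _ _)
    have hJM : insert j₀ J' ⊆ M := insert_subset hj₀ hJ'M
    have hJc : (insert j₀ J').card = k - X.card + 1 := by
      rw [card_insert_of_notMem hj₀J', hJ'c]
    refine exists_nearAcceptable_of_parts hM hF hA hinj hown (J := insert j₀ J')
      (fun j hj => hM2 j (hJM hj)) ?_ ?_
    · intro E hE
      by_cases hj : j₀ ∈ E
      · have h2 := card_le_card hE
        have h3 := card_le_card (subset_biUnion_of_mem (fun j => F ∩ avail L (W j)) hj)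
        change _ ≤ (E.biUnion fun j => F ∩ avail L (W j)).card
        omega
      · exact hHall J' hJ'M (by omega) E fun x hx =>
          (mem_insert.1 (hE hx)).resolve_left fun h => hj (h ▸ hx)
    · have h1 := hJsum _ hJM
      rw [hJc] at h1 ⊢
      change _ ≤ k + ∑ j ∈ insert j₀ J', (W j).card
      omega
  -- All estimates are now equalities: the parts in `M` are wholly uncoloured pairs, and each class
  -- of `g` has at most one vertex. Some part has three or more vertices, and one of them, `v`, is
  -- coloured; a vertex `u` of a pair sees its colour.
  exfalso
  push Not at hslack
  have htight : ∀ j ∈ M, ∀ c ∉ F,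
      ∑ v ∈ W j, wt L v c = 2 * (X.filter fun v => (g v).1 = c).card := by
    intro j hj c hc
    have h1 := two_mul_le_card_inter_avail hF H.card_list (W j)
    have h2 := hslack j hj
    have h3 := hM.sum_card_classes
    have h4 : ∑ c ∈ Fᶜ, 2 * (X.filter fun v => (g v).1 = c).card ≤ ∑ c ∈ Fᶜ, ∑ v ∈ W j, wt L v c := by
      rw [← mul_sum]; omega
    exact ((sum_eq_sum_iff_of_le fun c hc => hM.sum_wt_le (hMP j hj) (mem_compl.1 hc)).1
      (le_antisymm (sum_le_sum fun c hc => hM.sum_wt_le (hMP j hj) (mem_compl.1 hc)) h4)) c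
      (mem_compl.2 hc)
  have hWeq : ∀ j ∈ M, W j = cls part j := by
    intro j hj
    refine subset_antisymm (hWP j) fun v hv => ?_
    rw [mem_cls] at hv
    refine mem_filter.2 ⟨mem_compl.2 fun hvX => ?_, hv⟩
    have h1 := hM.sum_wt_lt hvX (by rw [hv]; exact hMP j hj)
    rw [hv] at h1
    exact h1.ne (htight j hj _ (mem_filter.1 (hM.isColoring.1 v hvX)).2)
  obtain ⟨j, hj⟩ : M.Nonempty := by
    rw [nonempty_iff_ne_empty]
    rintro h
    rw [h] at hWsum
    simp only [card_empty, sum_empty] at hWsum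
    omega
  have hcls : ∀ j ∈ M, (cls part j).card = 2 := fun j hj => by
    have h1 := hM2 j hj
    have h2 := hbig j hj
    rw [hWeq j hj] at h1 h2
    omega
  have hg1 : ∀ c ∉ F, (X.filter fun v => (g v).1 = c).card ≤ 1 := by
    intro c hc
    have h1 := htight j hj c hc
    have h2 := sum_wt_add_two_le (H.not_mem_avail_part j (hMP j hj) c)
    rw [hWeq j hj] at h1
    rw [hcls j hj] at h2
    omega
  obtain ⟨i, hi⟩ : ∃ i, 3 ≤ (cls part i).card := by
    by_contra! h
    have h1 : ∑ j ∈ univ.image part, (cls part j).card ≤ (univ.image part).card * 2 :=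
      sum_le_card_nsmul _ _ _ fun j _ => by have := h j; omega
    rw [H.sum_card_parts, H.card_parts] at h1
    omega
  obtain ⟨v, hvX, hvi⟩ : ∃ v ∈ X, part v = i := by
    by_contra! h
    have hsub : cls part i ⊆ W i := fun v hv =>
      mem_filter.2 ⟨mem_compl.2 fun hvX => h v hvX (mem_cls.1 hv), mem_cls.1 hv⟩
    have h1 := card_le_card hsub
    obtain ⟨v, hv⟩ := card_pos.1 (show 0 < (cls part i).card by omega)
    have hiM : i ∈ M := mem_filter.2 ⟨mem_image.2 ⟨v, mem_univ v, mem_cls.1 hv⟩, by omega⟩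
    have := hcls i hiM
    omega
  have hcF : (g v).1 ∉ F := (mem_filter.1 (hM.isColoring.1 v hvX)).2
  have hgv : X.filter (fun u => (g u).1 = (g v).1) = {v} := by
    have hv : v ∈ X.filter fun u => (g u).1 = (g v).1 := mem_filter.2 ⟨hvX, rfl⟩
    exact eq_singleton_iff_unique_mem.2 ⟨hv, fun x hx => card_le_one.1 (hg1 _ hcF) x hx v hv⟩
  obtain ⟨u, huW, hu⟩ : ∃ u ∈ W j, 0 < wt L u (g v).1 := by
    by_contra! h
    have h1 := htight j hj _ hcF
    rw [sum_eq_zero fun u hu => Nat.le_zero.1 (h u hu), hgv, card_singleton] at h1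
    omega
  obtain ⟨s, hs⟩ := wt_pos_iff.1 hu
  have huj : part u = j := (mem_filter.1 huW).2
  have huX : u ∉ X := mem_compl.1 (mem_filter.1 huW).1
  have hrep := hM.isColoring.replace (Y := {u}) (j := j) (c := (g v).1) (s := s) (by
    intro x hx
    rw [mem_singleton] at hx
    subst hx
    exact ⟨huj, mem_filter.2 ⟨hs, hcF⟩⟩)
  have hXv : (X.filter fun u => (g u).1 ≠ (g v).1) = X.erase v := by
    ext x
    have : (x ∈ X ∧ (g x).1 = (g v).1) ↔ x = v := by
      rw [← mem_filter (p := fun x => (g x).1 = (g v).1), hgv, mem_singleton]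
    rw [mem_filter, mem_erase]
    tauto
  rw [hXv] at hrep
  have huv : u ∉ X.erase v := fun h => huX (mem_of_mem_erase h)
  have hXc := card_pos.2 ⟨v, hvX⟩
  -- Swapping `v` for `u` keeps the size of `X` but uncolours a vertex of a big part; the second
  -- maximality condition exists to exclude this.
  have hfin := hM.card_big_le _ (disjoint_union_left.2
    ⟨hM.disjoint.mono_left (erase_subset _ _), MaxPartial.disjoint_of_part (hMP j hj) (by simp [huj])⟩)
    hrep (by
      rw [card_union_of_disjoint (disjoint_singleton_right.2 huv), card_erase_of_mem hvX,
        card_singleton]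
      omega)
  refine absurd hfin (not_le.2 (card_lt_card ?_))
  rw [ssubset_iff_of_subset]
  · refine ⟨v, mem_filter.2 ⟨?_, by rw [hvi]; exact hi⟩, fun h => mem_compl.1 (mem_filter.1 h).1 hvX⟩
    rw [mem_compl, mem_union, mem_singleton]
    rintro (h | h)
    · exact notMem_erase v X h
    · exact huX (h ▸ hvX)
  · intro x hx
    rw [mem_filter, mem_compl] at hx
    refine mem_filter.2 ⟨?_, hx.2⟩
    rw [mem_compl, mem_union, mem_singleton]
    rintro (h | h)
    · exact hx.1 (mem_of_mem_erase h)
    · have := hx.2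
      rw [h, huj, hcls j hj] at this
      omega

end Critical

/-! ### The final contradiction -/

namespace Critical

variable {part : V → ι} {L : V → Finset (α × Bool)} {k : ℕ}

/-- `F` is padded to `k` colours by distinct colours owned by lone vertices. Their classes are
acceptable, so only colours of `F` remain exceptional. -/
theorem exists_nearAcceptable_of_le (H : Critical part L k) {F : Finset α} (hF : F.card ≤ k)
    (hk : k ≤ F.card + (lone part).card) : ∃ f, NearAcceptable part L F f := by
  have := H.nonempty_colors
  obtain ⟨T, hT, hTcard⟩ := exists_subset_card_eq (show k - F.card ≤ (lone part).card by omega)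
  obtain ⟨g, hg, hgt⟩ := exists_injOn_of_hall T (fun v => avail L {v} \ F) (by
    intro E hE
    rcases E.eq_empty_or_nonempty with rfl | ⟨v, hv⟩
    · simp
    · calc E.card ≤ k - F.card := hTcard ▸ card_le_card hE
        _ ≤ (avail L {v}).card - F.card := Nat.sub_le_sub_right (H.le_card_avail_singleton v) _
        _ ≤ (avail L {v} \ F).card := le_card_sdiff _ _
        _ ≤ _ := card_le_card (subset_biUnion_of_mem (fun v => avail L {v} \ F) hv))
  have hinv : ∀ a, ∃ v, a ∈ T.image g → v ∈ T ∧ g v = a := by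
    intro a
    by_cases ha : a ∈ T.image g
    · obtain ⟨v, hv, hva⟩ := mem_image.1 ha
      exact ⟨v, fun _ => ⟨hv, hva⟩⟩
    · exact ⟨H.nonempty_vert.some, fun h => absurd h ha⟩
  choose own hown using hinv
  have hdis : Disjoint F (T.image g) := by
    rw [disjoint_right]
    intro a ha
    obtain ⟨v, hv, rfl⟩ := mem_image.1 ha
    exact (mem_sdiff.1 (hgt v hv)).2
  obtain ⟨f, hf⟩ := H.exists_nearAcceptable (F := F ∪ T.image g) (A := T.image g) (own := own)
    (by rw [card_union_of_disjoint hdis, card_image_of_injOn hg, hTcard]; omega)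
    subset_union_right
    (fun a ha b hb hab => by rw [← (hown a ha).2, ← (hown b hb).2, hab])
    (fun a ha => by
      refine ⟨hT (hown a ha).1, ?_⟩
      have := (mem_sdiff.1 (hgt _ (hown a ha).1)).1
      rw [(hown a ha).2, mem_avail_singleton] at this
      exact this)
  rw [union_sdiff_right, sdiff_eq_self_of_disjoint hdis] at hf
  exact ⟨f, hf⟩

/-- There are no critical list assignments. -/
theorem false_of_critical (H : Critical part L k) : False := by
  set t := (lone part).card with ht
  set m := Fintype.card α with hm
  set θ : α → ℕ := fun c => ∑ v ∈ lone part, wt L v c with hθ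
  have hmle : m ≤ 2 * k := H.card_colors_le
  -- The thresholds come from the certificate: a colour outside `N` has total weight at most `4k -
  -- 2|N| ≤ 2k`, and weight at most `2|P| ≤ 2(2k - m)` on lone vertices.
  set F := univ.filter fun c => 2 * k + 1 ≤ ∑ v, wt L v c ∨ 2 * (2 * k - m) + 1 ≤ θ c with hF
  have hFnot : ∀ c ∉ F, ∑ v, wt L v c ≤ 2 * k ∧ θ c ≤ 2 * (2 * k - m) := by
    intro c hc
    simp only [hF, mem_filter, mem_univ, true_and, not_or, not_le] at hc
    omega
  have hθP : ∀ (N : Finset α) (P : Finset V), P ⊆ lone part →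
      (∀ v ∈ lone part, v ∉ P → ∀ c ∉ N, wt L v c = 0) → ∀ c ∉ N, θ c ≤ 2 * P.card := by
    intro N P hP h0 c hc
    calc θ c = ∑ v ∈ P, wt L v c := (sum_subset hP fun v hv hvP => h0 v hv hvP c hc).symm
      _ ≤ ∑ v ∈ P, 2 := sum_le_sum fun v _ => wt_le_two L v c
      _ = 2 * P.card := by simp [mul_comm]
  have hFN : ∀ (N : Finset α) (P : Finset V), k ≤ N.card → P ⊆ lone part →
      P.card + m ≤ 2 * k → (∀ c ∉ N, ∑ v, wt L v c + 2 * N.card ≤ 4 * k) →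
      (∀ v ∈ lone part, v ∉ P → ∀ c ∉ N, wt L v c = 0) → F ⊆ N := by
    intro N P hkN hP hPm h1 h0 c hc
    by_contra hcN
    have h2 := h1 c hcN
    have h3 := hθP N P hP h0 c hcN
    simp only [hF, mem_filter, mem_univ, true_and] at hc
    omega
  by_cases hcase : k ≤ F.card + t
  · obtain ⟨F₁, hF₁, hF₁c⟩ := exists_subset_card_eq (min_le_left F.card k)
    obtain ⟨f, hf⟩ := H.exists_nearAcceptable_of_le (F := F₁) (by omega) (by omega)
    obtain ⟨N, P, hkN, ⟨c₀, hc₀, hc₀N⟩, hP, hPm, -, h1, h0⟩ := H.exists_certificate hf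
    exact hc₀N (hFN N P hkN hP hPm h1 h0 (hF₁ hc₀))
  push Not at hcase
  have hkm : k ≤ m := H.le_card_colors
  -- The colour missed by `N` will lie in `A`. As `A` is heaviest on lone vertices, its bound `2|P|`
  -- passes to every colour outside `F ∪ A`.
  obtain ⟨A, hAF, hA, htop⟩ := exists_top_subset θ Fᶜ (k - F.card)
    (by rw [card_compl]; omega)
  have hdis : Disjoint F A := disjoint_right.2 fun a ha => mem_compl.1 (hAF ha)
  obtain ⟨f, hf⟩ := H.exists_nearAcceptable (F := F ∪ A) (A := ∅) (own := fun _ => H.nonempty_vert.some)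
    (by rw [card_union_of_disjoint hdis]; omega) (empty_subset _) (by simp) (by simp)
  rw [sdiff_empty] at hf
  obtain ⟨N, P, hkN, ⟨c₀, hc₀, hc₀N⟩, hP, hPm, hPN, h1, h0⟩ := H.exists_certificate hf
  have hFsub : F ⊆ N := hFN N P hkN hP hPm h1 h0
  have hc₀A : c₀ ∈ A := (mem_union.1 hc₀).resolve_left fun h => hc₀N (hFsub h)
  have hθc₀ := hθP N P hP h0 c₀ hc₀N
  have hFcard := card_le_card hFsub
  have hNF : (N \ F).card = N.card - F.card := card_sdiff_of_subset hFsub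
  have hPle : P.card ≤ t := card_le_card hP
  obtain ⟨y, hy⟩ := Nat.exists_eq_add_of_le hkN
  obtain ⟨γ, hγ⟩ := Nat.exists_eq_add_of_le (show m ≤ 2 * k + 1 by omega)
  -- counting the lists of the lone vertices outside `P`
  have hE : ((k : ℤ) - F.card) * (t + 1 - P.card - γ) ≤ y * P.card := by
    have e1 : ∀ v ∈ lone part \ P, 2 * (k - F.card) ≤ ∑ c ∈ N \ F, wt L v c := by
      intro v hv
      rw [mem_sdiff] at hv
      have h2 : ∑ c ∈ N, wt L v c = 2 * k := by
        rw [← H.card_list v, ← sum_wt_univ L v]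
        exact sum_subset (subset_univ _) fun c _ hc => h0 v hv.1 hv.2 c hc
      rw [← sum_sdiff hFsub] at h2
      have h3 : ∑ c ∈ F, wt L v c ≤ ∑ c ∈ F, 2 := sum_le_sum fun c _ => wt_le_two L v c
      simp only [sum_const, smul_eq_mul] at h3
      omega
    have e2 : (t - P.card) * (2 * (k - F.card)) ≤ ∑ c ∈ N \ F, θ c := by
      calc _ = ∑ v ∈ lone part \ P, 2 * (k - F.card) := by
            rw [sum_const, card_sdiff_of_subset hP, smul_eq_mul]
        _ ≤ ∑ v ∈ lone part \ P, ∑ c ∈ N \ F, wt L v c := sum_le_sum e1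
        _ ≤ ∑ v ∈ lone part, ∑ c ∈ N \ F, wt L v c := sum_le_sum_of_subset sdiff_subset
        _ = _ := sum_comm
    have e3 : ∑ c ∈ N \ F, θ c ≤ ((N \ F) ∩ A).card * (2 * (2 * k - m)) +
        ((N \ F) \ A).card * (2 * P.card) := by
      rw [← sum_inter_add_sum_sdiff (N \ F) A]
      refine add_le_add ?_ ?_
      · refine sum_le_card_nsmul _ _ _ fun c hc => ?_
        exact (hFnot c (mem_sdiff.1 (mem_inter.1 hc).1).2).2
      · refine sum_le_card_nsmul _ _ _ fun c hc => ?_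
        rw [mem_sdiff, mem_sdiff] at hc
        exact (htop c₀ hc₀A c (mem_compl.2 hc.1.2) hc.2).trans hθc₀
    have e4 : ((N \ F) ∩ A).card + ((N \ F) \ A).card = (N \ F).card := card_inter_add_card_sdiff _ _
    have e5 : ((N \ F) ∩ A).card ≤ A.card := card_le_card inter_subset_right
    generalize ((N \ F) ∩ A).card = a at *
    generalize ((N \ F) \ A).card = b at *
    have e6 := e2.trans e3
    zify [hPle, show F.card ≤ k by omega, hmle] at e6
    have hγ' : (γ : ℤ) = 2 * k + 1 - m := by omega
    have hb : (b : ℤ) = k - F.card + y - a := by omega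
    have ha : (a : ℤ) ≤ k - F.card := by omega
    rw [hb] at e6
    have hpγ : (P.card : ℤ) ≤ 2 * k - m := by omega
    rw [hγ']
    nlinarith [mul_le_mul_of_nonneg_left hpγ (sub_nonneg.2 ha)]
  -- counting all lists
  have hD : (k : ℤ) * γ + y * (k + 1 - γ - y) ≤ F.card * (t + 1) := by
    have e1 : ∑ c, ∑ v, wt L v c = (2 * k + 1) * (2 * k) := by
      rw [sum_comm]
      simp only [sum_wt_univ, H.card_list, sum_const, card_univ, H.card_vert, smul_eq_mul]
    rw [← sum_add_sum_compl N, ← sum_sdiff hFsub] at e1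
    have e2 : ∑ c ∈ F, ∑ v, wt L v c ≤ F.card * (2 * k + 2 + 2 * t) :=
      sum_le_card_nsmul _ _ _ fun c _ => by have := H.sum_wt_le c; omega
    have e3 : ∑ c ∈ N \ F, ∑ v, wt L v c ≤ (N \ F).card * (2 * k) :=
      sum_le_card_nsmul _ _ _ fun c hc => (hFnot c (mem_sdiff.1 hc).2).1
    have e4 : ∑ c ∈ Nᶜ, ∑ v, wt L v c ≤ Nᶜ.card * (4 * k - 2 * N.card) :=
      sum_le_card_nsmul _ _ _ fun c hc => by have := h1 c (mem_compl.1 hc); omega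
    have hN2 : N.card ≤ 2 * k := by omega
    rw [card_compl, ← hm] at e4
    rw [hNF] at e3
    have e5 : (2 * k + 1) * (2 * k) ≤ (N.card - F.card) * (2 * k) + F.card * (2 * k + 2 + 2 * t) +
      (m - N.card) * (4 * k - 2 * N.card) := by omega
    zify [hFcard, show N.card ≤ m by omega, show 2 * N.card ≤ 4 * k by omega] at e5
    have hNy : (N.card : ℤ) = k + y := by omega
    have hγ' : (m : ℤ) = 2 * k + 1 - γ := by omega
    rw [hNy, hγ'] at e5
    nlinarith
  have hγ1 : 1 ≤ γ := by omega
  by_cases hpair : ∃ j, (cls part j).card = 2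
  · obtain ⟨j, hj⟩ := hpair
    have hm2 := H.card_colors_of_pair hj
    have hγ' : γ = 1 := by omega
    have hp0 : P.card = 0 := by omega
    exact ineq_pair (t := t) (y := y) (k := k) (φ := F.card) (by omega) (by omega)
      (by omega) (by omega) (by simpa [hγ', hp0] using hE) (by simpa [hγ'] using hD)
  · push Not at hpair
    have hk2 := H.le_two_mul_card_lone hpair
    exact ineq_lone (s := t + 1) (γ := γ) (y := y) (k := k) (p := P.card) (φ := F.card) (by omega)
      (by omega) (by omega) (by omega) (by omega) (by omega) (by omega) (by omega) hE hD

end Critical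

end Finite

/-! ### Induction on the number of parts and vertices -/

section Induction

universe u v w

theorem colorableOn_of_subtype {V : Type u} {ι : Type v} {α : Type w} [Nonempty α] {part : V → ι}
    {X : Finset V} {L : V → Finset (α × Bool)}
    (h : ColorableOn (fun v : X => part v) univ fun v => L v) : ColorableOn part X L := by
  obtain ⟨f, hf⟩ := h
  refine ⟨fun v => if hv : v ∈ X then f ⟨v, hv⟩ else (Classical.arbitrary α, true),
    fun v hv => ?_, fun u hu v hv huv => ?_⟩
  · simp only [hv, dif_pos]
    exact hf.1 ⟨v, hv⟩ (mem_univ _)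
  · simp only [hu, hv, dif_pos] at huv ⊢
    exact hf.2 ⟨u, hu⟩ (mem_univ _) ⟨v, hv⟩ (mem_univ _) huv

theorem image_subtype {V : Type u} {ι : Type v} (part : V → ι) (X : Finset V) :
    univ.image (fun v : X => part v) = X.image part := by
  ext j
  simp

/-- If no two vertices of a part share a pair (colour, sign), then all vertices can get distinct
colours. -/
theorem colorableOn_of_no_sharing {V : Type u} {ι : Type v} {α : Type w} [Fintype V] [Nonempty α]
    {part : V → ι} {L : V → Finset (α × Bool)} {k : ℕ} (hparts : (univ.image part).card ≤ k)
    (hL : ∀ v, (L v).card = 2 * k)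
    (hno : ∀ u v, u ≠ v → part u = part v → Disjoint (L u) (L v)) : ColorableOn part univ L := by
  obtain ⟨g, hg, hgt⟩ := exists_injOn_of_hall (univ : Finset V) (fun v => (L v).image Prod.fst) (by
    intro S _
    rcases S.eq_empty_or_nonempty with rfl | hS
    · simp
    -- The fullest part of `S` has at least `|S| / k` vertices with disjoint lists of `2k` pairs,
    -- hence sees at least `|S|` colours.
    obtain ⟨j, hj, hmax⟩ := exists_max_image (S.image part)
      (fun j => (S.filter fun v => part v = j).card) (hS.image _)
    have h1 : S.card ≤ (S.filter fun v => part v = j).card * k := by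
      refine (card_le_mul_card_image S _ hmax).trans (Nat.mul_le_mul_left _ ?_)
      exact (card_le_card (image_subset_image (subset_univ S))).trans hparts
    have h2 : (S.filter fun v => part v = j).biUnion L ⊆
        (S.biUnion fun v => (L v).image Prod.fst) ×ˢ (univ : Finset Bool) := by
      intro x hx
      obtain ⟨v, hv, hx⟩ := mem_biUnion.1 hx
      exact mem_product.2 ⟨mem_biUnion.2 ⟨v, (mem_filter.1 hv).1, mem_image_of_mem _ hx⟩, mem_univ _⟩
    have h3 := card_le_card h2
    rw [card_biUnion fun u hu v hv huv =>
        hno u v huv ((mem_filter.1 hu).2.trans (mem_filter.1 hv).2.symm), card_product,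
      sum_const_nat fun v _ => hL v, card_univ, Fintype.card_bool] at h3
    have h4 : (S.filter fun v => part v = j).card * (2 * k) =
      2 * ((S.filter fun v => part v = j).card * k) := by ring
    change _ ≤ (S.biUnion fun v => (L v).image Prod.fst).card
    omega)
  have hs : ∀ v, ∃ s, (g v, s) ∈ L v := fun v => by
    obtain ⟨⟨c, s⟩, hx, hc⟩ := mem_image.1 (hgt v (mem_univ v))
    exact ⟨s, by rw [← hc]; exact hx⟩
  choose s hs using hs
  refine ⟨fun v => (g v, s v), fun v _ => hs v, fun u _ v _ huv => ?_⟩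
  have : u = v := hg (by simp) (by simp) huv
  subst this
  exact ⟨rfl, rfl⟩

/-- Colouring a set of vertices of one part by one colour and the other vertices by induction. -/
theorem colorableOn_of_remove {V : Type u} {ι : Type v} {α : Type w} [Fintype V]
    {part : V → ι} {L : V → Finset (α × Bool)} {k : ℕ} (hL : ∀ v, (L v).card = 2 * k)
    (ih : ∀ (X : Finset V) (L' : V → Finset (α × Bool)), (X.image part).card ≤ k - 1 →
      X.card ≤ 2 * (k - 1) + 1 → (∀ v ∈ X, 2 * (k - 1) ≤ (L' v).card) → ColorableOn part X L')
    {R : Finset V} {j : ι} {c : α} {s : Bool} (hR : ∀ v ∈ R, part v = j ∧ (c, s) ∈ L v)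
    (hparts : (Rᶜ.image part).card ≤ k - 1) (hcard : Rᶜ.card ≤ 2 * (k - 1) + 1) :
    ColorableOn part univ L := by
  obtain ⟨f, hf⟩ := ih Rᶜ (fun v => (L v).filter fun x => x.1 ∉ ({c} : Finset α)) hparts hcard
    (fun v _ => by
      have h1 := card_le_card_filter_color_add L v {c}
      rw [hL, card_singleton] at h1
      omega)
  have hconst : IsColoringOn part R L (fun _ => (c, s)) :=
    ⟨fun v hv => (hR v hv).2, fun u hu v hv _ => ⟨(hR u hu).1.trans (hR v hv).1.symm, rfl⟩⟩
  have := hconst.union (hf.mono_list fun v _ => filter_subset _ _) (by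
    intro u _ v hv h
    have := (mem_filter.1 (hf.1 v hv)).2
    simp only [mem_singleton] at this
    exact this h.symm)
  rw [union_compl] at this
  exact ⟨_, this⟩

theorem card_image_compl_lt {V : Type u} {ι : Type v} [Fintype V] {part : V → ι} {R : Finset V}
    {w : V} (hR : ∀ u, part u = part w → u ∈ R) :
    (Rᶜ.image part).card < (univ.image part).card := by
  refine card_lt_card ((ssubset_iff_of_subset (image_subset_image (subset_univ _))).2
    ⟨part w, mem_image_of_mem _ (mem_univ w), fun h => ?_⟩)
  obtain ⟨u, hu, huw⟩ := mem_image.1 h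
  exact mem_compl.1 hu (hR u huw)

/-- Two vertices sharing a pair can be coloured together, which suffices for induction if fewer than
`k` parts are present. With `k` parts and at most `2k` vertices, either a lone vertex can be removed
or all parts have size two and the pair is a whole part. -/
theorem colorableOn_of_slack {V : Type u} {ι : Type v} {α : Type w} [Fintype V] [Nonempty α]
    {part : V → ι} {L : V → Finset (α × Bool)} {k : ℕ} (hk : 0 < k)
    (hL : ∀ v, (L v).card = 2 * k) (hparts : (univ.image part).card ≤ k)
    (hcard : Fintype.card V ≤ 2 * k + 1)
    (hslack : (univ.image part).card < k ∨ Fintype.card V ≤ 2 * k)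
    (ih : ∀ (X : Finset V) (L' : V → Finset (α × Bool)), (X.image part).card ≤ k - 1 →
      X.card ≤ 2 * (k - 1) + 1 → (∀ v ∈ X, 2 * (k - 1) ≤ (L' v).card) → ColorableOn part X L') :
    ColorableOn part univ L := by
  by_cases hshare : ∀ u v, u ≠ v → part u = part v → Disjoint (L u) (L v)
  · exact colorableOn_of_no_sharing hparts hL hshare
  push Not at hshare
  obtain ⟨u, v, huv, hpart, hdis⟩ := hshare
  rw [not_disjoint_iff] at hdis
  obtain ⟨⟨c, s⟩, hcu, hcv⟩ := hdis
  have hpair : ∀ x ∈ ({u, v} : Finset V), part x = part v ∧ (c, s) ∈ L x := by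
    intro x hx
    rcases mem_insert.1 hx with rfl | hx
    · exact ⟨hpart, hcu⟩
    · rw [mem_singleton.1 hx]
      exact ⟨rfl, hcv⟩
  have hpaircard : (({u, v} : Finset V)ᶜ).card + 2 = Fintype.card V := by
    rw [← card_pair huv, card_compl_add_card]
  have hsingle : ∀ x : V, (({x} : Finset V)ᶜ).card + 1 = Fintype.card V := fun x => by
    rw [← card_singleton x, card_compl_add_card]
  have hmono : ∀ R : Finset V, (Rᶜ.image part).card ≤ (univ.image part).card := fun R =>
    card_le_card (image_subset_image (subset_univ _))
  by_cases hlt : (univ.image part).card < k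
  · refine colorableOn_of_remove hL ih hpair ?_ (by omega)
    have := hmono {u, v}
    omega
  have hcard' : Fintype.card V ≤ 2 * k := by omega
  rcases (lone part).eq_empty_or_nonempty with hl | ⟨x, hx⟩
  · have h2 : ∀ j ∈ univ.image part, 2 ≤ (cls part j).card := by
      intro j hj
      obtain ⟨y, -, rfl⟩ := mem_image.1 hj
      by_contra! hlt2
      have : y ∈ lone part := mem_lone.2 fun z hz =>
        card_le_one.1 (show (cls part (part y)).card ≤ 1 by omega) z (mem_cls.2 hz) y (mem_cls.2 rfl)
      rw [hl] at this
      exact notMem_empty _ this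
    have hsum : ∑ j ∈ univ.image part, (cls part j).card = Fintype.card V := by
      rw [← card_univ, card_eq_sum_card_image part]
      rfl
    have h3 : (cls part (part v)).card ≤ 2 := by
      by_contra! h
      have h4 : ∑ j ∈ univ.image part, 2 < ∑ j ∈ univ.image part, (cls part j).card :=
        sum_lt_sum h2 ⟨part v, mem_image_of_mem _ (mem_univ v), h⟩
      rw [sum_const, smul_eq_mul, hsum] at h4
      omega
    have h5 : cls part (part v) = {u, v} := by
      refine (eq_of_subset_of_card_le (fun x hx => mem_cls.2 (hpair x hx).1) ?_).symm
      rw [card_pair huv]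
      exact h3
    refine colorableOn_of_remove hL ih hpair ?_ (by omega)
    have := card_image_compl_lt (part := part) (R := {u, v}) (w := v) fun y hy => by
      rw [← h5]; exact mem_cls.2 hy
    omega
  · obtain ⟨⟨c', s'⟩, hc'⟩ := card_pos.1 (show 0 < (L x).card by rw [hL]; omega)
    refine colorableOn_of_remove hL ih (R := {x}) (j := part x) (c := c') (s := s') ?_ ?_ ?_
    · intro y hy
      rw [mem_singleton.1 hy]
      exact ⟨rfl, hc'⟩
    · have := card_image_compl_lt (part := part) (R := {x}) (w := x) fun y hy =>
        mem_singleton.2 (mem_lone.1 hx y hy)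
      omega
    · have := hsingle x
      omega

/-- Lists of size `2 * k` suffice for `k` parts and at most `2 * k + 1` vertices. -/
theorem colorableOn_univ (k n : ℕ) : ∀ (V : Type u) (ι : Type v) (α : Type w) [Fintype V]
    (part : V → ι) (L : V → Finset (α × Bool)), Fintype.card V = n → (univ.image part).card ≤ k →
    n ≤ 2 * k + 1 → (∀ v, 2 * k ≤ (L v).card) → ColorableOn part univ L := by
  induction k using Nat.strong_induction_on generalizing n with
  | _ k ihk =>
  induction n using Nat.strong_induction_on with
  | _ n ihn =>
  intro V ι α _ part L₀ hn hparts hnk hL₀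
  rcases isEmpty_or_nonempty V with hV | ⟨⟨v₀⟩⟩
  · exact ⟨fun v => (hV.false v).elim, fun v => (hV.false v).elim, fun v => (hV.false v).elim⟩
  have hk : 0 < k := lt_of_lt_of_le
    (card_pos.2 ⟨part v₀, mem_image_of_mem _ (mem_univ v₀)⟩) hparts
  have hα : Nonempty α := by
    obtain ⟨x, -⟩ := card_pos.1 (show 0 < (L₀ v₀).card by have := hL₀ v₀; omega)
    exact ⟨x.1⟩
  have hsub : ∀ v, ∃ T ⊆ L₀ v, T.card = 2 * k := fun v => exists_subset_card_eq (hL₀ v)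
  choose L hLL₀ hL using hsub
  suffices h : ColorableOn part univ L from
    h.imp fun f hf => hf.mono_list fun v _ => hLL₀ v
  have ih₁ : ∀ (β : Type w) [Nonempty β] (X : Finset V) (L' : V → Finset (β × Bool)) (k' : ℕ),
      k' < k → (X.image part).card ≤ k' → X.card ≤ 2 * k' + 1 → (∀ v ∈ X, 2 * k' ≤ (L' v).card) →
      ColorableOn part X L' := by
    intro β _ X L' k' hk' h1 h2 h3
    exact colorableOn_of_subtype (ihk k' hk' X.card X ι β _ _ (Fintype.card_coe X)
      (by rw [image_subtype]; exact h1) h2 fun v => h3 v v.2)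
  have ih₂ : ∀ (β : Type w) [Nonempty β] (X : Finset V) (L' : V → Finset (β × Bool)),
      X ≠ univ → (∀ v ∈ X, 2 * k ≤ (L' v).card) → ColorableOn part X L' := by
    intro β _ X L' h1 h2
    have hX : X.card < n := by
      rw [← hn, ← card_univ]
      exact card_lt_card (ssubset_univ_iff.2 h1)
    refine colorableOn_of_subtype (ihn X.card hX X ι β _ _ (Fintype.card_coe X) ?_ (by omega)
      fun v => h2 v v.2)
    rw [image_subtype]
    exact (card_le_card (image_subset_image (subset_univ X))).trans hparts
  by_cases hslack : (univ.image part).card < k ∨ Fintype.card V ≤ 2 * k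
  · exact colorableOn_of_slack hk hL hparts (by omega) hslack
      fun X L' h1 h2 h3 => ih₁ α X L' (k - 1) (by omega) h1 h2 h3
  push Not at hslack
  -- restrict to the colours that occur in the lists
  let C : Finset α := univ.biUnion fun v => (L v).image Prod.fst
  let φ : C × Bool → α × Bool := Prod.map Subtype.val id
  have hφ : Function.Injective φ := Subtype.val_injective.prodMap Function.injective_id
  have hC : ∀ v, ∀ x ∈ L v, x.1 ∈ C := fun v x hx =>
    mem_biUnion.2 ⟨v, mem_univ v, mem_image_of_mem _ hx⟩
  let L' : V → Finset (C × Bool) := fun v => (L v).preimage φ hφ.injOn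
  have hL' : ∀ v x, x ∈ L' v ↔ φ x ∈ L v := fun v x => mem_preimage
  have hCne : Nonempty C := by
    obtain ⟨x, hx⟩ := card_pos.1 (show 0 < (L v₀).card by have := hL v₀; omega)
    exact ⟨⟨x.1, hC v₀ x hx⟩⟩
  by_contra hcol
  have hcrit : Critical part L' k :=
    { card_parts := le_antisymm hparts hslack.1
      card_vert := by omega
      card_list := fun v => by
        rw [← hL v, card_preimage, filter_true_of_mem]
        exact fun x hx => ⟨(⟨x.1, hC v x hx⟩, x.2), rfl⟩
      appears := fun c => by
        obtain ⟨v, -, hv⟩ := mem_biUnion.1 c.2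
        obtain ⟨x, hx, hxc⟩ := mem_image.1 hv
        refine ⟨v, wt_pos_iff.2 ⟨x.2, (hL' _ _).2 ?_⟩⟩
        simp only [φ, Prod.map, id, ← hxc]
        exact hx
      not_colorable := fun ⟨f, hf⟩ => hcol ⟨fun v => φ (f v), fun v hv => (hL' _ _).1 (hf.1 v hv),
        fun u hu v hv huv => hf.2 u hu v hv (Subtype.ext huv)⟩
      colorable_of_lt := ih₁ C
      colorable_of_ne_univ := ih₂ C }
  exact hcrit.false_of_critical

end Induction

end SignedListColoring

/-! ### Translation from signed graphs -/

namespace SignedGraph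

open Finset

theorem sign_relation {a b x y : ℤ} {σ : ℤˣ} (hb : b ≠ 0) (hy : y ≠ 0)
    (hxy : x = σ * y) (hab : a.natAbs = b.natAbs) (h : 0 < x * a ↔ 0 < y * b) : a = σ * b := by
  have hyb : y * b ≠ 0 := mul_ne_zero hy hb
  rcases Int.units_eq_one_or σ with rfl | rfl <;> rcases Int.natAbs_eq_natAbs_iff.1 hab with rfl | rfl <;>
    simp only [Units.val_one, Units.val_neg, one_mul, neg_mul] at hxy ⊢ <;> subst hxy <;>
    exfalso <;> simp only [neg_mul, mul_neg] at h <;> omega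

theorem zeroFreeChoosable_of_zeroFreeColorable {V E : Type*} [Finite V] (S : SignedGraph V E)
    {k : ℕ} (hcol : S.ZeroFreeColorable k) (hV : Nat.card V ≤ 2 * k + 1) :
    S.ZeroFreeChoosable k := by
  classical
  have := Fintype.ofFinite V
  obtain ⟨f₀, hf₀, hf₀k⟩ := hcol
  intro L hL0 hL
  have hT : ∀ v, ∃ T : Finset ℤ, (T : Set ℤ) ⊆ L v ∧ T.card = 2 * k := by
    intro v
    obtain ⟨t, ht, hc⟩ := Set.exists_subset_encard_eq (hL v)
    have hfin : t.Finite := Set.finite_of_encard_eq_coe hc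
    refine ⟨hfin.toFinset, by simpa using ht, ?_⟩
    rw [hfin.encard_eq_coe_toFinset_card] at hc
    exact_mod_cast hc
  choose T hTL hTc using hT
  have hT0 : ∀ v, ∀ c ∈ T v, c ≠ 0 := fun v c hc h => hL0 v (h ▸ hTL v hc)
  -- The second entry switches signs by `f₀`, so that inside a part equal entries never conflict
  -- along an edge.
  let φ : V → ℤ → ℕ × Bool := fun v c => (c.natAbs, decide (0 < c * f₀ v))
  have hφ : ∀ v, Set.InjOn (φ v) (T v) := by
    intro v a ha b hb hab
    simp only [φ, Prod.mk.injEq, decide_eq_decide] at hab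
    have h := sign_relation (σ := 1) (hT0 v b hb) (hf₀k v).1 (x := f₀ v) (by simp) hab.1
      (by rw [mul_comm, hab.2, mul_comm])
    simpa using h
  have hparts : ∀ inst : DecidableEq ℕ,
      (@Finset.image V ℕ inst (fun v => (f₀ v).natAbs) univ).card ≤ k := by
    intro inst
    obtain rfl : inst = instDecidableEqNat := Subsingleton.elim _ _
    refine (card_le_card (t := Finset.Icc 1 k) fun j hj => ?_).trans (by simp)
    obtain ⟨v, -, rfl⟩ := mem_image.1 hj
    obtain ⟨h1, h2⟩ := hf₀k v
    rw [abs_le] at h2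
    rw [mem_Icc]
    omega
  obtain ⟨f, hf⟩ := SignedListColoring.colorableOn_univ k (Fintype.card V) V ℕ ℕ
    (fun v => (f₀ v).natAbs) (fun v => (T v).image (φ v)) rfl (hparts _)
    (by rwa [← Nat.card_eq_fintype_card]) (fun v => by
      rw [card_image_of_injOn (hφ v), hTc])
  have hc : ∀ v, ∃ c ∈ T v, φ v c = f v := fun v => by simpa using hf.1 v (mem_univ v)
  choose c hcT hcf using hc
  refine ⟨c, fun e u v he hcuv => ?_, fun v => hTL v (hcT v)⟩
  have habs : (c u).natAbs = (c v).natAbs := by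
    rw [hcuv, Int.natAbs_mul, Int.units_natAbs, one_mul]
  have h := hf.2 u (mem_univ u) v (mem_univ v) (by rw [← hcf, ← hcf]; exact habs)
  rw [← hcf, ← hcf] at h
  simp only [φ, decide_eq_decide] at h
  exact hf₀ e u v he (sign_relation (hf₀k v).1 (hT0 v _ (hcT v)) hcuv h.1 h.2)

theorem zeroFreeColorable_of_zeroFreeChoosable {V E : Type*} (S : SignedGraph V E) {k : ℕ}
    (h : S.ZeroFreeChoosable k) : S.ZeroFreeColorable k := by
  refine h (fun _ => zeroFreeColors k) (fun _ h => h.1 rfl) fun _ => ?_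
  have : zeroFreeColors k = (((Finset.Icc (-(k : ℤ)) k).erase 0 : Finset ℤ) : Set ℤ) := by
    ext c
    simp [zeroFreeColors, abs_le, and_comm]
  rw [this, Set.encard_coe_eq_coe_finsetCard, card_erase_of_mem (by simp), Int.card_Icc]
  norm_cast
  omega

end SignedGraph

theorem theorem1p2 {V E : Type*} [Finite V] (S : SignedGraph V E)
    (hS : Nat.card V ≤ S.zeroFreeChromaticNumber + 1) :
    S.ZeroFreeChromaticChoosable := by
  obtain ⟨⟨k, hk, hcol⟩, hmin⟩ := S.isLeast_zeroFreeChromaticNumber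
  obtain ⟨⟨k', hk', hch⟩, hmin'⟩ := S.isLeast_zeroFreeListChromaticNumber
  refine le_antisymm ?_ ?_
  · exact hmin' ⟨k, hk, S.zeroFreeChoosable_of_zeroFreeColorable hcol (by omega)⟩
  · exact hmin ⟨k', hk', S.zeroFreeColorable_of_zeroFreeChoosable hch⟩
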